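/- All simplicial complexes are finite, and a geometric realization of an abstract complex is a geometric simplicial complex in some $\mathbb R^n$ whose simplices are exactly those spanned by the simplices of the abstract one (its underlying space is $|\cdot|$). Let $f\colon K\to L$ be a simplicial map between simplicial complexes with vertex sets $V$, $W$ and geometric realizations $|K|$, $|L|$, and fix a total order on $V$. *The constructions.* - The product $K\times I$ has vertex set $V\times\{0,1\}$; writing $x=(x,0)$ and $x'=(x,1)$, its simplices are the sets $[x_0,\dots,x_k,x_k',\dots,x_m']$, for $[x_0<\dots<x_m]\in K$ and $0\le k\le m$, and their nonempty subsets. $K\times\{0\}$ is the inner layer, $K\times\{1\}$ the outer layer. - The simplicial cone $\mathrm{Cone}_s(K)$ is $K\times I$ together with a new vertex $x^*$ and all the simplices $\{x^*\}$ and $\sigma\cup\{x^*\}$, $\sigma\in K\times\{0\}$. - The simplicial mapping cylinder $\mathrm{Cyl}_s(f)$ has vertex set $V\sqcup W$; its simplices are those of $L$, and the sets $[x_0,\dots,x_k,f(x_k'),\dots,f(x_m')]$ for $[x_0,\dots,x_k,x_k',\dots,x_m']$ as above, with their nonempty subsets. - The simplicial mapping cone $\mathrm{Cone}_s(f)$ is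 obtained from $\mathrm{Cyl}_s(f)$ by coning its inner layer at a new vertex: add a vertex $x^*$ and the simplices $\{x^*\}$ and $\sigma\cup\{x^*\}$, $\sigma\in K\times\{0\}$. - The topological cone $C(X)$ is $X\times[0,1]$ with $X\times\{0\}$ identified to one point (and $C(\emptyset)$ is a point); the mapping cone of $|f|\colon|K|\to|L|$ is $C(f)=C(|K|)\sqcup_{|f|}|L|$, obtained by identifying $(x,1)$ with $|f|(x)$. Let $|\mathrm{Cone}_s(K)|$ and $|\mathrm{Cone}_s(f)|$ be any geometric realizations. The vertex map that fixes $x^*$ and the inner layer and is $f$ on the outer layer induces a map $\pi\colon|\mathrm{Cone}_s(K)|\to|\mathrm{Cone}_s(f)|$, and the inclusion of $W$ induces $j\colon|L|\to|\mathrm{Cone}_s(f)|$. *The result.* 1. There is a homeomorphism $\Phi\colon C(|K|)\to|\mathrm{Cone}_s(K)|$ that sends $(x,1)$ to the point $x$ of the outer layer, for every $x\in|K|$. 2. For every such $\Phi$, the map $(\pi\circ\Phi)\sqcup j\colon C(|K|)\sqcup|L|\to|\mathrm{Cone}_s(f)|$ descends to a continuous map $q'\colon C(f)\to|\mathrm{Cone}_s(f)|$,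 and $q'$ is a homotopy equivalence. 3. The construction uses fewer simplices than the classical ones. The classical two-layer cylinder (Cohen) has as simplices the simplices of $L$, the nonempty chains $c$ of simplices of $K$ (the simplices of the barycentric subdivision $\mathrm{sd}\,K$), and the joins $c\cup b$ of such a chain with a simplex $b$ of $L$ contained in $f(\sigma)$ for every $\sigma\in c$; its mapping cone cones $\mathrm{sd}\,K$ at a new vertex. The classical three-layer cylinder (Whitehead) consists of the two-layer cylinder of $f$ and that of $\mathrm{id}_K$, glued along $\mathrm{sd}\,K$; its mapping cone cones the inner layer $K$ at a new vertex. Then $\mathrm{Cone}_s(f)$ has at most as many simplices as the two-layer mapping cone, strictly fewer if $K$ has an edge, and it has strictly fewer simplices than the three-layer mapping cone if $K$ is nonempty. -/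

import Mathlib

open scoped unitInterval

/-! ### Topological cones and mapping cones -/

/-- The relation generating the cone: every point `(x, 0)` is identified with the apex. -/
inductive ConeRel (X : Type*) : (X × I) ⊕ Unit → (X × I) ⊕ Unit → Prop
  | apex (x : X) : ConeRel X (Sum.inl (x, 0)) (Sum.inr ())

/-- The (unreduced) cone on `X`: the product `X × [0,1]` with `X × {0}` collapsed to one point, the
apex. The apex is adjoined before the identification, so that the cone on the empty space is a
point; for nonempty `X` this is the quotient of `X × [0,1]`. -/
def TopCone (X : Type*) : Type _ := Quot (ConeRel X)

instance (X : Type*) [TopologicalSpace X] : TopologicalSpace (TopCone X) :=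
  inferInstanceAs (TopologicalSpace (Quot (ConeRel X)))

/-- The point of the cone represented by `(x, t)`. -/
def TopCone.mk {X : Type*} (x : X) (t : I) : TopCone X := Quot.mk _ (Sum.inl (x, t))

/-- The relation generating the mapping cone: the point `(x, 1)` of the cone is identified with
`f x`. -/
inductive MapConeRel {X Y : Type*} (f : X → Y) : TopCone X ⊕ Y → TopCone X ⊕ Y → Prop
  | glue (x : X) : MapConeRel f (Sum.inl (TopCone.mk x 1)) (Sum.inr (f x))

/-- The topological mapping cone of `f : X → Y`: the gluing of the cone on `X` to `Y` along
`X × {1}` via `f`. -/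
def TopMapCone {X Y : Type*} (f : X → Y) : Type _ := Quot (MapConeRel f)

instance {X Y : Type*} [TopologicalSpace X] [TopologicalSpace Y] (f : X → Y) :
    TopologicalSpace (TopMapCone f) :=
  inferInstanceAs (TopologicalSpace (Quot (MapConeRel f)))

/-- The canonical map from the cone on `X` to the mapping cone. -/
def TopMapCone.ofCone {X Y : Type*} (f : X → Y) (z : TopCone X) : TopMapCone f :=
  Quot.mk _ (Sum.inl z)

/-- The canonical map from `Y` to the mapping cone. -/
def TopMapCone.ofTarget {X Y : Type*} (f : X → Y) (y : Y) : TopMapCone f :=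
  Quot.mk _ (Sum.inr y)

/-- A continuous map is a homotopy equivalence if it has a homotopy inverse. -/
def IsHomotopyEquivalence {X Y : Type*} [TopologicalSpace X] [TopologicalSpace Y]
    (q : C(X, Y)) : Prop :=
  ∃ g : C(Y, X), (g.comp q).Homotopic (ContinuousMap.id X) ∧
    (q.comp g).Homotopic (ContinuousMap.id Y)

/-! ### Simplicial maps and geometric realizations -/

/-- A simplicial map between abstract simplicial complexes: a map of vertices that sends simplices
to simplices. -/
structure SimplicialMap {V W : Type*} [DecidableEq W]
    (A : AbstractSimplicialComplex V) (B : AbstractSimplicialComplex W) where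
  toFun : V → W
  map_faces : ∀ s ∈ A.faces, s.image toFun ∈ B.faces

/-- The identity simplicial map. -/
def SimplicialMap.refl {V : Type*} [DecidableEq V] (A : AbstractSimplicialComplex V) :
    SimplicialMap A A where
  toFun := id
  map_faces := fun s hs => by simpa using hs

/-- A geometric realization in `ℝⁿ` of an abstract simplicial complex `A`: a geometric simplicial
complex in `ℝⁿ`, together with a placement of the vertices, whose simplices are exactly those
spanned by the simplices of `A`. -/
structure GeomRealization {V : Type*} (A : AbstractSimplicialComplex V) (n : ℕ) where
  complex : Geometry.SimplicialComplex ℝ (EuclideanSpace ℝ (Fin n))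
  pos : V ↪ EuclideanSpace ℝ (Fin n)
  faces_eq : complex.faces = {t | ∃ s ∈ A.faces, t = s.map pos}

namespace GeomRealization

variable {V W : Type*} [Fintype V] [Fintype W] [DecidableEq W]
  {A : AbstractSimplicialComplex V} {B : AbstractSimplicialComplex W} {n m : ℕ}

/-- The underlying space: the union of the simplices, with the topology of `ℝⁿ`. -/
abbrev Space {V : Type*} {A : AbstractSimplicialComplex V} {n : ℕ} (K : GeomRealization A n) :
    Type := K.complex.space

/-- `w` is a system of barycentric coordinates of `x`: nonnegative weights of sum one, positive
exactly on the vertices of some simplex, with barycentre `x`. -/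
def IsBary (K : GeomRealization A n) (x : EuclideanSpace ℝ (Fin n)) (w : V → ℝ) : Prop :=
  (∀ v, 0 ≤ w v) ∧ ∑ v, w v = 1 ∧ (Finset.univ.filter fun v => w v ≠ 0) ∈ A.faces ∧
    ∑ v, w v • K.pos v = x

theorem exists_isBary (K : GeomRealization A n) (x : K.Space) : ∃ w, K.IsBary x w := by
  classical
  obtain ⟨x, hx⟩ := x
  obtain ⟨t, ht, hxt⟩ := Geometry.SimplicialComplex.mem_space_iff.1 hx
  rw [K.faces_eq] at ht
  obtain ⟨s, hs, rfl⟩ := ht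
  rw [Finset.mem_convexHull'] at hxt
  obtain ⟨w, hw0, hw1, hwx⟩ := hxt
  rw [Finset.sum_map] at hw1 hwx
  have h1 : ∑ v, (if v ∈ s then w (K.pos v) else 0) = 1 := by
    rw [Finset.sum_ite_mem, Finset.univ_inter, hw1]
  refine ⟨fun v => if v ∈ s then w (K.pos v) else 0, ?_, h1, ?_, ?_⟩
  · intro v
    dsimp only
    split_ifs with h
    · exact hw0 _ (Finset.mem_map_of_mem _ h)
    · exact le_rfl
  · refine (A.isRelLowerSet_faces hs).2 ?_ ?_
    · intro v hv
      by_contra h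
      simp [h] at hv
    · by_contra h
      rw [Finset.not_nonempty_iff_eq_empty, Finset.filter_eq_empty_iff] at h
      have h0 : ∑ v, (if v ∈ s then w (K.pos v) else 0) = 0 :=
        Finset.sum_eq_zero fun v hv => by simpa using h hv
      rw [h0] at h1
      exact zero_ne_one h1
  · simp only [ite_smul, zero_smul]
    rw [Finset.sum_ite_mem, Finset.univ_inter]
    exact hwx

/-- The barycentric coordinates of a point of the underlying space. -/
noncomputable def bary (K : GeomRealization A n) (x : K.Space) : V → ℝ :=
  (K.exists_isBary x).choose

theorem bary_spec (K : GeomRealization A n) (x : K.Space) : K.IsBary x (K.bary x) :=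
  (K.exists_isBary x).choose_spec

end GeomRealization

/-- The map of underlying spaces induced by a simplicial map: it sends the point with barycentric
coordinates `(w v)` to the barycentre of the images of the vertices `v` with the weights `w v`. -/
noncomputable def SimplicialMap.realize {V W : Type*} [Fintype V] [DecidableEq W]
    {A : AbstractSimplicialComplex V} {B : AbstractSimplicialComplex W} {n m : ℕ}
    (f : SimplicialMap A B) (K : GeomRealization A n) (L : GeomRealization B m)
    (x : K.Space) : L.Space :=
  ⟨∑ v, K.bary x v • L.pos (f.toFun v), by
    classical
    obtain ⟨h0, h1, h2, -⟩ := K.bary_spec x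
    refine Geometry.SimplicialComplex.mem_space_iff.2
      ⟨((Finset.univ.filter fun v => K.bary x v ≠ 0).image f.toFun).map L.pos, ?_, ?_⟩
    · rw [L.faces_eq]
      exact ⟨_, f.map_faces _ h2, rfl⟩
    · have hsub : ∑ v ∈ Finset.univ.filter (fun v => K.bary x v ≠ 0), K.bary x v = 1 := by
        rw [Finset.sum_filter_ne_zero, h1]
      have hsum : ∑ v, K.bary x v • L.pos (f.toFun v) =
          ∑ v ∈ Finset.univ.filter (fun v => K.bary x v ≠ 0),
            K.bary x v • L.pos (f.toFun v) := by
        rw [Finset.sum_filter]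
        refine Finset.sum_congr rfl fun v _ => ?_
        by_cases h : K.bary x v = 0 <;> simp [h]
      rw [hsum]
      refine (convex_convexHull ℝ _).sum_mem (fun v _ => h0 v) hsub fun v hv => ?_
      refine subset_convexHull ℝ _ (Finset.mem_coe.2 ?_)
      exact Finset.mem_map_of_mem _ (Finset.mem_image_of_mem _ hv)⟩

/-! ### Coning a subcomplex at a new vertex -/

/-- The cone on `S` at the new vertex `none`: the simplices are the nonempty sets whose vertices
other than `none` form a simplex of `S` or the empty set. -/
def coneAt {U : Type*} (S : PreAbstractSimplicialComplex U) :
    PreAbstractSimplicialComplex (Option U) where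
  faces := {t | t.Nonempty ∧ (t.eraseNone = ∅ ∨ t.eraseNone ∈ S.faces)}
  isRelLowerSet_faces := by
    rintro t ⟨hne, ht⟩
    refine ⟨hne, fun u hut hu => ⟨hu, ?_⟩⟩
    have hsub : u.eraseNone ⊆ t.eraseNone := Finset.eraseNone.monotone hut
    rcases ht with ht | ht
    · exact Or.inl (Finset.subset_empty.1 (ht ▸ hsub))
    · rcases Finset.eq_empty_or_nonempty u.eraseNone with h | h
      · exact Or.inl h
      · exact Or.inr ((S.isRelLowerSet_faces ht).2 hsub h)

/-- The complex obtained from `A` by coning its subcomplex `S` at the new vertex `none`. -/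
def coneOff {U : Type*} [DecidableEq U] (A S : PreAbstractSimplicialComplex U) :
    PreAbstractSimplicialComplex (Option U) :=
  A.map some ⊔ coneAt S

theorem PreAbstractSimplicialComplex.mem_sup_faces {U : Type*}
    {A B : PreAbstractSimplicialComplex U} {s : Finset U} :
    s ∈ (A ⊔ B).faces ↔ s ∈ A.faces ∨ s ∈ B.faces := Iff.rfl

theorem coneOff_singleton_mem {U : Type*} [DecidableEq U] {A : PreAbstractSimplicialComplex U}
    (hA : ∀ u, {u} ∈ A.faces) (S : PreAbstractSimplicialComplex U) (u : Option U) :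
    {u} ∈ (coneOff A S).faces := by
  cases u with
  | none => exact Or.inr ⟨Finset.singleton_nonempty _, Or.inl (by ext; simp)⟩
  | some u => exact Or.inl ⟨{u}, hA u, by simp⟩

theorem coneOff_map_faces {U U' : Type*} [DecidableEq U] [DecidableEq U']
    {A S : PreAbstractSimplicialComplex U} {A' S' : PreAbstractSimplicialComplex U'} (g : U → U')
    (hA : ∀ s ∈ A.faces, s.image g ∈ A'.faces) (hS : ∀ s ∈ S.faces, s.image g ∈ S'.faces)
    (t : Finset (Option U)) (ht : t ∈ (coneOff A S).faces) :
    t.image (Option.map g) ∈ (coneOff A' S').faces := by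
  rcases ht with ⟨s, hs, rfl⟩ | ⟨hne, ht⟩
  · refine Or.inl ⟨s.image g, hA s hs, ?_⟩
    simp only [Finset.image_image]
    rfl
  · refine Or.inr ⟨hne.image _, ?_⟩
    have he : (t.image (Option.map g)).eraseNone = t.eraseNone.image g := by
      ext u
      simp only [Finset.mem_eraseNone, Finset.mem_image, Option.map_eq_some_iff]
      constructor
      · rintro ⟨a, ha, b, rfl, rfl⟩
        exact ⟨b, ha, rfl⟩
      · rintro ⟨b, hb, rfl⟩
        exact ⟨some b, hb, b, rfl, rfl⟩
    rw [he]
    rcases ht with ht | ht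
    · exact Or.inl (by rw [ht]; rfl)
    · exact Or.inr (hS _ ht)

/-! ### The simplicial product, cone, mapping cylinder and mapping cone -/

section Constructions

variable {V W : Type*} [LinearOrder V] [DecidableEq W]

/-- For a simplex `s = [x₀ < ⋯ < xₘ]` and its vertex `k = xᵢ`, the simplex
`[x₀, …, xᵢ, xᵢ', …, xₘ']` of the product, where `x = (x, 0)` and `x' = (x, 1)`. -/
def prismSimplex (s : Finset V) (k : V) : Finset (V × Fin 2) :=
  (s.filter (· ≤ k)).image (fun v => (v, 0)) ∪ (s.filter (k ≤ ·)).image (fun v => (v, 1))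

/-- The product of `A` with the standard `1`-simplex, for the given order on the vertices of `A`:
the simplices are those of the form `prismSimplex s k` and their faces. -/
def simpProd (A : AbstractSimplicialComplex V) : PreAbstractSimplicialComplex (V × Fin 2) where
  faces := {t | t.Nonempty ∧ ∃ s ∈ A.faces, ∃ k ∈ s, t ⊆ prismSimplex s k}
  isRelLowerSet_faces := by
    rintro t ⟨hne, s, hs, k, hk, ht⟩
    exact ⟨hne, fun u hu hu' => ⟨hu', s, hs, k, hk, hu.trans ht⟩⟩

theorem simpProd_singleton_mem (A : AbstractSimplicialComplex V) (p : V × Fin 2) :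
    {p} ∈ (simpProd A).faces := by
  obtain ⟨v, i⟩ := p
  refine ⟨Finset.singleton_nonempty _, {v}, A.singleton_mem v, v, by simp, ?_⟩
  fin_cases i <;> simp [prismSimplex]

/-- The simplicial cone on `A`: the product of `A` with the standard `1`-simplex, with the inner
layer `A × {0}` coned at a new vertex. -/
def simpCone (A : AbstractSimplicialComplex V) :
    AbstractSimplicialComplex (Option (V × Fin 2)) where
  toPreAbstractSimplicialComplex :=
    coneOff (simpProd A) (A.toPreAbstractSimplicialComplex.map fun v => (v, 0))
  singleton_mem := coneOff_singleton_mem (simpProd_singleton_mem A) _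

/-- The vertices of `A × {0}` are kept and those of `A × {1}` are sent to the target by `f`. -/
def cylVertex {A : AbstractSimplicialComplex V} {B : AbstractSimplicialComplex W}
    (f : SimplicialMap A B) (p : V × Fin 2) : V ⊕ W :=
  if p.2 = 0 then Sum.inl p.1 else Sum.inr (f.toFun p.1)

/-- The simplicial mapping cylinder of `f`: the simplices are those of the target, and the
`[x₀, …, xᵢ, f xᵢ', …, f xₘ']` with their faces. -/
def simpMapCyl {A : AbstractSimplicialComplex V} {B : AbstractSimplicialComplex W}
    (f : SimplicialMap A B) : PreAbstractSimplicialComplex (V ⊕ W) :=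
  (simpProd A).map (cylVertex f) ⊔ B.toPreAbstractSimplicialComplex.map Sum.inr

theorem simpMapCyl_singleton_mem {A : AbstractSimplicialComplex V}
    {B : AbstractSimplicialComplex W} (f : SimplicialMap A B) (u : V ⊕ W) :
    {u} ∈ (simpMapCyl f).faces := by
  rcases u with v | w
  · exact Or.inl ⟨{(v, 0)}, simpProd_singleton_mem A _, by simp [cylVertex]⟩
  · exact Or.inr ⟨{w}, B.singleton_mem w, by simp⟩

/-- The simplicial mapping cone of `f`: the simplicial mapping cylinder with its inner layer coned
at a new vertex. -/
def simpMapCone {A : AbstractSimplicialComplex V} {B : AbstractSimplicialComplex W}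
    (f : SimplicialMap A B) : AbstractSimplicialComplex (Option (V ⊕ W)) where
  toPreAbstractSimplicialComplex :=
    coneOff (simpMapCyl f) (A.toPreAbstractSimplicialComplex.map Sum.inl)
  singleton_mem := coneOff_singleton_mem (simpMapCyl_singleton_mem f) _

/-- The inclusion of `A` in its simplicial cone as the outer layer `A × {1}`. -/
def outerLayer (A : AbstractSimplicialComplex V) : SimplicialMap A (simpCone A) where
  toFun v := some (v, 1)
  map_faces := fun s hs => by
    have hne : s.Nonempty := (A.isRelLowerSet_faces hs).1
    refine Or.inl ⟨s.image fun v => (v, 1), ⟨hne.image _, s, hs, s.min' hne, s.min'_mem hne, ?_⟩,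
      by simp only [Finset.image_image]; rfl⟩
    intro p hp
    obtain ⟨v, hv, rfl⟩ := Finset.mem_image.1 hp
    exact Finset.mem_union_right _
      (Finset.mem_image_of_mem _ (Finset.mem_filter.2 ⟨hv, s.min'_le v hv⟩))

/-- The inclusion of the target in the simplicial mapping cone. -/
def targetInclusion {A : AbstractSimplicialComplex V} {B : AbstractSimplicialComplex W}
    (f : SimplicialMap A B) : SimplicialMap B (simpMapCone f) where
  toFun w := some (Sum.inr w)
  map_faces := fun s hs => by
    refine Or.inl ⟨s.image Sum.inr, Or.inr ⟨s, hs, rfl⟩, ?_⟩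
    simp only [Finset.image_image]
    rfl

/-- The simplicial map from the simplicial cone on the source to the simplicial mapping cone, which
identifies the outer layer with its image in the target via `f`. -/
def coneQuotient {A : AbstractSimplicialComplex V} {B : AbstractSimplicialComplex W}
    (f : SimplicialMap A B) : SimplicialMap (simpCone A) (simpMapCone f) where
  toFun := Option.map (cylVertex f)
  map_faces := coneOff_map_faces _ (fun s hs => Or.inl ⟨s, hs, rfl⟩) (by
    rintro _ ⟨s, hs, rfl⟩
    refine ⟨s, hs, ?_⟩
    simp only [Finset.image_image]
    rfl)

/-! ### The classical simplicial mapping cones -/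

/-- The barycentric subdivision of `A`: its vertices are the simplices of `A` and its simplices are
the nonempty chains of simplices of `A`. -/
def barySubdiv (A : AbstractSimplicialComplex V) : PreAbstractSimplicialComplex A.faces where
  faces := {c | c.Nonempty ∧ IsChain (fun s t : A.faces => s.1 ⊆ t.1) (c : Set A.faces)}
  isRelLowerSet_faces := by
    rintro c ⟨hne, hc⟩
    exact ⟨hne, fun d hd hd' => ⟨hd', hc.mono (Finset.coe_subset.2 hd)⟩⟩

/-- The classical two-layer simplicial mapping cylinder (Cohen): the inner layer is the barycentric
subdivision of the source, the outer layer is the target. The simplices are the joins `c ∪ b` of a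
chain `c` of simplices of the source and a simplex `b` of the target, one of them possibly empty,
with `b ⊆ f(s)` for all `s` in `c`. -/
def cohenCyl {A : AbstractSimplicialComplex V} {B : AbstractSimplicialComplex W}
    (f : SimplicialMap A B) : PreAbstractSimplicialComplex (A.faces ⊕ W) where
  faces := {t | t.Nonempty ∧
    IsChain (fun s s' : A.faces => s.1 ⊆ s'.1) (t.toLeft : Set A.faces) ∧
    (t.toRight = ∅ ∨ t.toRight ∈ B.faces) ∧ ∀ s ∈ t.toLeft, t.toRight ⊆ s.1.image f.toFun}
  isRelLowerSet_faces := by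
    rintro t ⟨hne, hc, hb, hcb⟩
    refine ⟨hne, fun u hu hu' => ?_⟩
    have hl : u.toLeft ⊆ t.toLeft := Finset.toLeft_subset_toLeft hu
    have hr : u.toRight ⊆ t.toRight := Finset.toRight_subset_toRight hu
    refine ⟨hu', hc.mono (Finset.coe_subset.2 hl), ?_, fun s hs => hr.trans (hcb s (hl hs))⟩
    rcases hb with hb | hb
    · exact Or.inl (Finset.subset_empty.1 (hb ▸ hr))
    · rcases Finset.eq_empty_or_nonempty u.toRight with h | h
      · exact Or.inl h
      · exact Or.inr ((B.isRelLowerSet_faces hb).2 hr h)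

/-- The simplicial mapping cone associated with the two-layer cylinder. -/
def cohenMapCone {A : AbstractSimplicialComplex V} {B : AbstractSimplicialComplex W}
    (f : SimplicialMap A B) : PreAbstractSimplicialComplex (Option (A.faces ⊕ W)) :=
  coneOff (cohenCyl f) ((barySubdiv A).map Sum.inl)

/-- The classical three-layer simplicial mapping cylinder (Whitehead): the inner layer is the source,
the middle layer its barycentric subdivision, and the outer layer the target. The inner half is the
two-layer cylinder of the identity, turned around. -/
def whiteheadCyl {A : AbstractSimplicialComplex V} {B : AbstractSimplicialComplex W}
    (f : SimplicialMap A B) : PreAbstractSimplicialComplex (V ⊕ (A.faces ⊕ W)) :=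
  (cohenCyl (SimplicialMap.refl A)).map (Sum.elim (fun s => Sum.inr (Sum.inl s)) Sum.inl) ⊔
    (cohenCyl f).map Sum.inr

/-- The simplicial mapping cone associated with the three-layer cylinder. -/
def whiteheadMapCone {A : AbstractSimplicialComplex V} {B : AbstractSimplicialComplex W}
    (f : SimplicialMap A B) : PreAbstractSimplicialComplex (Option (V ⊕ (A.faces ⊕ W))) :=
  coneOff (whiteheadCyl f) (A.toPreAbstractSimplicialComplex.map Sum.inl)

end Constructions

/-!
Everything is done in barycentric coordinates: a geometric realization is homeomorphic to the space
`weightSpace` of weights supported on simplices (`GeomRealization.coordHomeo`), and simplicial maps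
act by pushing weights forward (`SimplicialMap.bary_realize`).

The homeomorphism from the topological to the simplicial cone is explicit (`coneWeight`). Its inner
half is the cone on the inner layer. On the outer half, `A × I`, the point at level `s` over a point
`x` is obtained by moving to the outer layer the part of `x` of mass `s` that lies on the largest
vertices (`topPart`). Splitting `x` in this way is continuous, its two parts span a simplex of the
prism, and it is the only such splitting of the given mass, so the map is a continuous bijection
from a compact space to a Hausdorff space.

The resulting map of mapping cones is a surjection of the same kind, hence a quotient map. It
identifies two points of the outer half of the cone when they have the same time, the same part left
on the inner layer, and parts on the outer layer with the same image in the target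
(`eq_or_exists_of_map_eq`). The homotopy that stretches the rays of the cone from `t` to
`min 1 (2 * t)` is compatible with these identifications, since moving further mass outwards depends
only on the part left on the inner layer (`topPart_eq_add`), and at its end the identified points
coincide in the target. So its end descends to a homotopy inverse
(`isHomotopyEquivalence_of_surjective`). Any other identification of the topological cone with the
simplicial one differs by a homeomorphism of the cone that fixes the base.

For the count, a simplex of the simplicial mapping cylinder that meets the source consists of an
inner part `u` and an outer part `y = f(z)`, with `z` above `u` and `u ∪ z` a simplex. It is encoded
by a simplex of the two-layer cylinder with the same outer part `y`, whose chain is `{u ∪ z}` or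
`{z, u ∪ z}` (`SplitCode`). Coning adds the new vertex and its joins with the simplices of the coned
subcomplex (`ncard_coneOff`), and a complex has at most as many simplices as its barycentric
subdivision.
-/

/-! ### Barycentric coordinates -/

/-- The standard realization of a finite complex: the systems of barycentric coordinates, that is,
the nonnegative weights of sum one whose support is a simplex. -/
def weightSpace {V : Type*} [Fintype V] (A : AbstractSimplicialComplex V) : Set (V → ℝ) :=
  {w | (∀ v, 0 ≤ w v) ∧ ∑ v, w v = 1 ∧ (Finset.univ.filter fun v => w v ≠ 0) ∈ A.faces}

theorem mem_weightSpace_of_subset {V : Type*} [Fintype V] {A : AbstractSimplicialComplex V}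
    {w : V → ℝ} (h0 : ∀ v, 0 ≤ w v) (h1 : ∑ v, w v = 1) {s : Finset V} (hs : s ∈ A.faces)
    (hws : ∀ v, w v ≠ 0 → v ∈ s) : w ∈ weightSpace A := by
  refine ⟨h0, h1, (A.isRelLowerSet_faces hs).2 (fun v hv => hws v (by simpa using hv)) ?_⟩
  by_contra h
  rw [Finset.not_nonempty_iff_eq_empty, Finset.filter_eq_empty_iff] at h
  have h2 : ∑ v, w v = 0 := Finset.sum_eq_zero fun v hv => by simpa using h hv
  rw [h2] at h1
  exact zero_ne_one h1

theorem isCompact_weightSpace {V : Type*} [Fintype V] (A : AbstractSimplicialComplex V) :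
    IsCompact (weightSpace A) := by
  have h : weightSpace A = ⋃ s ∈ A.faces, {w | ∀ v ∉ s, w v = 0} ∩ stdSimplex ℝ V := by
    ext w
    simp only [Set.mem_iUnion, exists_prop]
    constructor
    · rintro ⟨h0, h1, h2⟩
      exact ⟨_, h2, fun v hv => by simpa using hv, h0, h1⟩
    · rintro ⟨s, hs, hw, h0, h1⟩
      exact mem_weightSpace_of_subset h0 h1 hs fun v hv => by
        by_contra h
        exact hv (hw v h)
  rw [h]
  refine A.faces.toFinite.isCompact_biUnion fun s _ => IsCompact.inter_left ?_ ?_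
  · exact isCompact_stdSimplex ℝ V
  · simp only [Set.ofPred_forall]
    exact isClosed_iInter fun v => isClosed_iInter fun _ =>
      isClosed_eq (continuous_apply v) continuous_const

namespace GeomRealization

variable {V : Type*} [Fintype V] {A : AbstractSimplicialComplex V} {n : ℕ}

theorem isBary_iff (K : GeomRealization A n) (x : EuclideanSpace ℝ (Fin n)) (w : V → ℝ) :
    K.IsBary x w ↔ w ∈ weightSpace A ∧ ∑ v, w v • K.pos v = x := by
  simp only [IsBary, weightSpace, Set.mem_ofPred_eq, and_assoc]

omit [Fintype V] in
theorem map_pos_mem_faces (K : GeomRealization A n) {s : Finset V} (hs : s ∈ A.faces) :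
    s.map K.pos ∈ K.complex.faces := by
  rw [K.faces_eq]
  exact ⟨s, hs, rfl⟩

theorem sum_smul_pos_mem_convexHull (K : GeomRealization A n) {w : V → ℝ} (h0 : ∀ v, 0 ≤ w v)
    (h1 : ∑ v, w v = 1) {s : Finset V} (hws : ∀ v, w v ≠ 0 → v ∈ s) :
    ∑ v, w v • K.pos v ∈ convexHull ℝ (s.map K.pos : Set (EuclideanSpace ℝ (Fin n))) := by
  have hz : ∀ v ∉ s, w v = 0 := fun v hv => by
    by_contra h
    exact hv (hws v h)
  rw [← Finset.sum_subset (Finset.subset_univ s) fun v _ hv => by simp [hz v hv]]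
  rw [← Finset.sum_subset (Finset.subset_univ s) fun v _ hv => hz v hv] at h1
  exact (convex_convexHull ℝ _).sum_mem (fun v _ => h0 v) h1 fun v hv =>
    subset_convexHull ℝ _ (Finset.mem_coe.2 (Finset.mem_map_of_mem _ hv))

theorem weights_eq_of_sum_eq (K : GeomRealization A n) {s : Finset V} (hs : s ∈ A.faces)
    {w w' : V → ℝ} (hw : ∀ v ∉ s, w v = 0) (hw' : ∀ v ∉ s, w' v = 0)
    (h1 : ∑ v, w v = ∑ v, w' v) (hx : ∑ v, w v • K.pos v = ∑ v, w' v • K.pos v) : w = w' := by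
  have hind : AffineIndependent ℝ (fun v : s => K.pos v) := by
    have h := K.complex.indep (K.map_pos_mem_faces hs)
    let e : s ↪ (s.map K.pos : Finset _) :=
      ⟨fun v => ⟨K.pos v, Finset.mem_map_of_mem _ v.2⟩, fun a b hab =>
        Subtype.ext (K.pos.injective (Subtype.ext_iff.1 hab))⟩
    exact h.comp_embedding e
  rw [affineIndependent_iff] at hind
  have key := hind Finset.univ (fun v => w v - w' v) ?_ ?_
  · funext v
    by_cases hv : v ∈ s
    · exact sub_eq_zero.1 (key ⟨v, hv⟩ (Finset.mem_univ _))
    · rw [hw v hv, hw' v hv]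
  · rw [Finset.sum_coe_sort s fun v => w v - w' v,
      Finset.sum_subset (Finset.subset_univ s) fun v _ hv => by simp [hw v hv, hw' v hv]]
    simp [h1]
  · rw [Finset.sum_coe_sort s fun v => (w v - w' v) • K.pos v,
      Finset.sum_subset (Finset.subset_univ s) fun v _ hv => by simp [hw v hv, hw' v hv]]
    simp [sub_smul, hx]

/-- Two systems of barycentric coordinates of a point agree: the point lies on the common face of
their supports, where it has coordinates with which both agree by affine independence. -/
theorem isBary_unique (K : GeomRealization A n) {x : EuclideanSpace ℝ (Fin n)} {w w' : V → ℝ}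
    (hw : K.IsBary x w) (hw' : K.IsBary x w') : w = w' := by
  classical
  obtain ⟨h0, h1, h2, h3⟩ := hw
  obtain ⟨h0', h1', h2', h3'⟩ := hw'
  set s := Finset.univ.filter fun v => w v ≠ 0 with hs
  set s' := Finset.univ.filter fun v => w' v ≠ 0 with hs'
  have hxs := K.sum_smul_pos_mem_convexHull h0 h1 (s := s) fun v hv => by simp [hs, hv]
  have hxs' := K.sum_smul_pos_mem_convexHull h0' h1' (s := s') fun v hv => by simp [hs', hv]
  rw [h3] at hxs
  rw [h3'] at hxs'
  have hx := K.complex.inter_subset_convexHull (K.map_pos_mem_faces h2) (K.map_pos_mem_faces h2')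
    ⟨hxs, hxs'⟩
  rw [← Finset.coe_inter, ← Finset.map_inter, Finset.mem_convexHull'] at hx
  obtain ⟨u, hu0, hu1, hux⟩ := hx
  rw [Finset.sum_map] at hu1 hux
  -- The weights `u` are supported on the common face, so both systems agree with them.
  have e1 : ∑ v, (if v ∈ s ∩ s' then u (K.pos v) else 0) = 1 := by
    rw [Finset.sum_ite_mem, Finset.univ_inter, hu1]
  have e2 : ∑ v, (if v ∈ s ∩ s' then u (K.pos v) else 0) • K.pos v = x := by
    simp only [ite_smul, zero_smul]
    rw [Finset.sum_ite_mem, Finset.univ_inter, hux]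
  have key : w = fun v => if v ∈ s ∩ s' then u (K.pos v) else 0 :=
    K.weights_eq_of_sum_eq h2 (fun v hv => by simpa [hs] using hv)
      (fun v hv => if_neg fun h => hv (Finset.mem_inter.1 h).1) (h1.trans e1.symm)
      (h3.trans e2.symm)
  have key' : w' = fun v => if v ∈ s ∩ s' then u (K.pos v) else 0 :=
    K.weights_eq_of_sum_eq h2' (fun v hv => by simpa [hs'] using hv)
      (fun v hv => if_neg fun h => hv (Finset.mem_inter.1 h).2) (h1'.trans e1.symm)
      (h3'.trans e2.symm)
  rw [key, key']

theorem bary_mem (K : GeomRealization A n) (x : K.Space) : K.bary x ∈ weightSpace A :=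
  ((K.isBary_iff _ _).1 (K.bary_spec x)).1

theorem sum_bary (K : GeomRealization A n) (x : K.Space) : ∑ v, K.bary x v • K.pos v = x :=
  (K.bary_spec x).2.2.2

theorem bary_eq (K : GeomRealization A n) {x : K.Space} {w : V → ℝ} (hw : w ∈ weightSpace A)
    (hx : ∑ v, w v • K.pos v = x) : K.bary x = w :=
  K.isBary_unique (K.bary_spec x) ((K.isBary_iff _ _).2 ⟨hw, hx⟩)

/-- The point of a geometric realization with given barycentric coordinates. -/
def ofWeight (K : GeomRealization A n) (w : weightSpace A) : K.Space :=
  ⟨∑ v, w.1 v • K.pos v, Geometry.SimplicialComplex.mem_space_iff.2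
    ⟨_, K.map_pos_mem_faces w.2.2.2,
      K.sum_smul_pos_mem_convexHull w.2.1 w.2.2.1 fun v hv => by simpa using hv⟩⟩

/-- Barycentric coordinates identify every geometric realization with the standard one. -/
noncomputable def coordHomeo (K : GeomRealization A n) : K.Space ≃ₜ weightSpace A :=
  haveI : CompactSpace (weightSpace A) := isCompact_iff_compactSpace.1 (isCompact_weightSpace A)
  (Continuous.homeoOfEquivCompactToT2 (f :=
    { toFun := K.ofWeight
      invFun := fun x => ⟨K.bary x, K.bary_mem x⟩
      left_inv := fun w => Subtype.ext (K.bary_eq w.2 rfl)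
      right_inv := fun x => Subtype.ext (K.sum_bary x) })
    (Continuous.subtype_mk (continuous_finsetSum _ fun v _ =>
      ((continuous_apply v).comp continuous_subtype_val).smul continuous_const) _)).symm

@[simp]
theorem coordHomeo_apply (K : GeomRealization A n) (x : K.Space) :
    (K.coordHomeo x : V → ℝ) = K.bary x := rfl

theorem continuous_bary (K : GeomRealization A n) : Continuous K.bary :=
  continuous_subtype_val.comp K.coordHomeo.continuous

theorem bary_injective (K : GeomRealization A n) : Function.Injective K.bary := fun _ _ h =>
  K.coordHomeo.injective (Subtype.ext h)

theorem bary_coordHomeo_symm (K : GeomRealization A n) (w : weightSpace A) :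
    K.bary (K.coordHomeo.symm w) = w := by
  rw [← coordHomeo_apply, Homeomorph.apply_symm_apply]

instance (K : GeomRealization A n) : CompactSpace K.Space :=
  haveI : CompactSpace (weightSpace A) := isCompact_iff_compactSpace.1 (isCompact_weightSpace A)
  K.coordHomeo.symm.compactSpace

end GeomRealization

/-- The pushforward of weights along a map of vertices. -/
def pushWeight {V W : Type*} [Fintype V] [DecidableEq W] (g : V → W) (w : V → ℝ) (y : W) : ℝ :=
  ∑ v, if g v = y then w v else 0

section pushWeight

variable {V W : Type*} [Fintype V] [DecidableEq W]

theorem pushWeight_nonneg {g : V → W} {w : V → ℝ} (h : ∀ v, 0 ≤ w v) (y : W) :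
    0 ≤ pushWeight g w y :=
  Finset.sum_nonneg fun v _ => by split_ifs <;> simp [h v]

theorem sum_pushWeight_smul [Fintype W] {E : Type*} [AddCommGroup E] [Module ℝ E] (g : V → W)
    (w : V → ℝ) (p : W → E) : ∑ y, pushWeight g w y • p y = ∑ v, w v • p (g v) := by
  simp only [pushWeight, Finset.sum_smul]
  rw [Finset.sum_comm]
  exact Finset.sum_congr rfl fun v _ => by simp [ite_smul]

theorem sum_pushWeight [Fintype W] (g : V → W) (w : V → ℝ) :
    ∑ y, pushWeight g w y = ∑ v, w v := by
  simpa using sum_pushWeight_smul g w (fun _ => (1 : ℝ))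

theorem exists_of_pushWeight_ne_zero {g : V → W} {w : V → ℝ} {y : W} (h : pushWeight g w y ≠ 0) :
    ∃ v, g v = y ∧ w v ≠ 0 := by
  obtain ⟨v, -, hv⟩ := Finset.exists_ne_zero_of_sum_ne_zero h
  exact ⟨v, by simpa using hv⟩

theorem pushWeight_add (g : V → W) (w w' : V → ℝ) :
    pushWeight g (w + w') = pushWeight g w + pushWeight g w' := by
  funext y
  simp only [pushWeight, Pi.add_apply, ← Finset.sum_add_distrib]
  exact Finset.sum_congr rfl fun v _ => by split_ifs <;> simp

theorem pushWeight_mem [Fintype W] {A : AbstractSimplicialComplex V}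
    {B : AbstractSimplicialComplex W} (f : SimplicialMap A B) {w : V → ℝ}
    (hw : w ∈ weightSpace A) : pushWeight f.toFun w ∈ weightSpace B := by
  refine mem_weightSpace_of_subset (pushWeight_nonneg hw.1) ((sum_pushWeight _ _).trans hw.2.1)
    (f.map_faces _ hw.2.2) fun y hy => ?_
  obtain ⟨v, rfl, hv⟩ := exists_of_pushWeight_ne_zero hy
  exact Finset.mem_image_of_mem _ (by simpa using hv)

theorem SimplicialMap.bary_realize [Fintype W] {A : AbstractSimplicialComplex V}
    {B : AbstractSimplicialComplex W} {n m : ℕ} (f : SimplicialMap A B) (K : GeomRealization A n)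
    (L : GeomRealization B m) (x : K.Space) :
    L.bary (f.realize K L x) = pushWeight f.toFun (K.bary x) :=
  L.bary_eq (pushWeight_mem f (K.bary_mem x)) (sum_pushWeight_smul _ _ _)

theorem continuous_pushWeight (g : V → W) : Continuous (pushWeight g) :=
  continuous_pi fun y => continuous_finsetSum _ fun v _ => by
    split_ifs
    · exact continuous_apply v
    · exact continuous_const

theorem SimplicialMap.continuous_realize [Fintype W] {A : AbstractSimplicialComplex V}
    {B : AbstractSimplicialComplex W} {n m : ℕ} (f : SimplicialMap A B) (K : GeomRealization A n)
    (L : GeomRealization B m) : Continuous (f.realize K L) := by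
  rw [← L.coordHomeo.comp_continuous_iff]
  refine Continuous.subtype_mk (((continuous_pushWeight f.toFun).comp K.continuous_bary).congr
    fun x => (f.bary_realize K L x).symm) _

end pushWeight

/-! ### Homotopy equivalences from surjections -/

/-- A surjection from a compact space to a Hausdorff space is a homotopy equivalence as soon as some
homotopy from the identity is compatible with its fibres and collapses each of them to a point at
time one: the end of the homotopy descends to a homotopy inverse. -/
theorem isHomotopyEquivalence_of_surjective {X Y : Type*} [TopologicalSpace X] [TopologicalSpace Y]
    [CompactSpace X] [T2Space Y] (q : C(X, Y)) (hq : Function.Surjective q) (D : C(I × X, X))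
    (h0 : ∀ a, D (0, a) = a)
    (hD : ∀ t a b, q a = q b → q (D (t, a)) = q (D (t, b)))
    (h1 : ∀ a b, q a = q b → D (1, a) = D (1, b)) : IsHomotopyEquivalence q := by
  have hquot : Topology.IsQuotientMap q := q.continuous.isClosedMap.isQuotientMap q.continuous hq
  have hquot' : Topology.IsQuotientMap (Prod.map id q : I × X → I × Y) := by
    have hc : Continuous (Prod.map id q : I × X → I × Y) := continuous_id.prodMap q.continuous
    have hs : Function.Surjective (Prod.map id q : I × X → I × Y) :=
      Function.surjective_id.prodMap hq
    exact hc.isClosedMap.isQuotientMap hc hs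
  -- `g` is the inverse and `G` the descended homotopy, both given by `D` on preimages.
  let r : Y → X := Function.surjInv hq
  have hr : ∀ y, q (r y) = y := Function.surjInv_eq hq
  let g : C(Y, X) := ⟨fun y => D (1, r y), hquot.continuous_iff.2 <|
    (show Continuous fun a => D (1, a) by fun_prop).congr fun a => h1 _ _ (hr (q a)).symm⟩
  let G : C(I × Y, Y) := ⟨fun p => q (D (p.1, r p.2)), hquot'.continuous_iff.2 <|
    (show Continuous fun p : I × X => q (D p) by fun_prop).congr fun p =>
      hD p.1 _ _ (hr (q p.2)).symm⟩
  refine ⟨g, ContinuousMap.Homotopic.symm ⟨⟨D, fun a => h0 a, fun a => ?_⟩⟩,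
    ContinuousMap.Homotopic.symm ⟨⟨G, fun y => ?_, fun y => rfl⟩⟩⟩
  · exact h1 _ _ (hr (q a)).symm
  · change q (D (0, r y)) = y
    rw [h0, hr]

theorem IsHomotopyEquivalence.comp_homeomorph {X Y Z : Type*} [TopologicalSpace X]
    [TopologicalSpace Y] [TopologicalSpace Z] {q : C(Y, Z)} (hq : IsHomotopyEquivalence q)
    (h : X ≃ₜ Y) : IsHomotopyEquivalence (q.comp (h : C(X, Y))) := by
  obtain ⟨g, hg, hg'⟩ := hq
  refine ⟨(h.symm : C(Y, X)).comp g, ?_, ?_⟩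
  · have := ((ContinuousMap.Homotopic.refl (h.symm : C(Y, X))).comp hg).comp
      (ContinuousMap.Homotopic.refl (h : C(X, Y)))
    convert this using 1
    · rfl
    · ext x
      exact (h.symm_apply_apply x).symm
  · convert hg' using 1
    ext y
    simp

/-! ### Maps out of cones and mapping cones -/

namespace TopCone

variable {X Y : Type*} [TopologicalSpace X] [TopologicalSpace Y]

/-- The apex of the cone. -/
def apex (X : Type*) : TopCone X := Quot.mk _ (Sum.inr ())

omit [TopologicalSpace X] in
theorem mk_zero (x : X) : mk x 0 = apex X := Quot.sound (ConeRel.apex x)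

omit [TopologicalSpace X] in
theorem ind {P : TopCone X → Prop} (h0 : P (apex X)) (h : ∀ x t, P (mk x t)) (z : TopCone X) :
    P z := by
  obtain ⟨⟨x, t⟩ | ⟨⟩⟩ := z
  exacts [h x t, h0]

theorem continuous_mk : Continuous fun p : X × I => mk p.1 p.2 :=
  continuous_quot_mk.comp continuous_inl

/-- The map out of the cone given by a homotopy that is constant at time zero. -/
def lift (g : C(X × I, Y)) (y : Y) (h : ∀ x, g (x, 0) = y) : C(TopCone X, Y) where
  toFun := Quot.lift (Sum.elim g fun _ => y) (by rintro _ _ ⟨x⟩; exact h x)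
  continuous_toFun := continuous_quot_lift _ (by fun_prop)

instance [CompactSpace X] : CompactSpace (TopCone X) :=
  inferInstanceAs (CompactSpace (Quot (ConeRel X)))

end TopCone

namespace TopMapCone

variable {X Y Z : Type*} [TopologicalSpace X] [TopologicalSpace Y] [TopologicalSpace Z] (f : X → Y)

omit [TopologicalSpace X] [TopologicalSpace Y] in
theorem ofCone_mk_one (x : X) : ofCone f (TopCone.mk x 1) = ofTarget f (f x) :=
  Quot.sound (MapConeRel.glue x)

omit [TopologicalSpace X] [TopologicalSpace Y] in
theorem ind {P : TopMapCone f → Prop} (h : ∀ z, P (ofCone f z)) (h' : ∀ y, P (ofTarget f y))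
    (a : TopMapCone f) : P a := by
  obtain ⟨z | y⟩ := a
  exacts [h z, h' y]

theorem continuous_ofCone : Continuous (ofCone f) := continuous_quot_mk.comp continuous_inl

theorem continuous_ofTarget : Continuous (ofTarget f) := continuous_quot_mk.comp continuous_inr

variable {f} in
/-- The map out of the mapping cone given by compatible maps on the cone and on the target. -/
def lift (g : C(TopCone X, Z)) (k : C(Y, Z)) (h : ∀ x, g (TopCone.mk x 1) = k (f x)) :
    C(TopMapCone f, Z) where
  toFun := Quot.lift (Sum.elim g k) (by rintro _ _ ⟨x⟩; exact h x)
  continuous_toFun := continuous_quot_lift _ (by fun_prop)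

instance [CompactSpace X] [CompactSpace Y] : CompactSpace (TopMapCone f) :=
  inferInstanceAs (CompactSpace (Quot (MapConeRel f)))

/-- A homeomorphism of the cone that fixes the base induces one of the mapping cone. -/
def homeoOfCone (h : TopCone X ≃ₜ TopCone X) (h1 : ∀ x, h (TopCone.mk x 1) = TopCone.mk x 1) :
    TopMapCone f ≃ₜ TopMapCone f where
  toFun := lift (f := f) (⟨_, (continuous_ofCone f).comp h.continuous⟩ : C(TopCone X, TopMapCone f))
    ⟨_, continuous_ofTarget f⟩ fun x => by
      change ofCone f (h _) = _
      rw [h1]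
      exact ofCone_mk_one f x
  invFun := lift (f := f)
    (⟨_, (continuous_ofCone f).comp h.symm.continuous⟩ : C(TopCone X, TopMapCone f))
    ⟨_, continuous_ofTarget f⟩ fun x => by
      change ofCone f (h.symm _) = _
      rw [h.symm_apply_eq.2 (h1 x).symm]
      exact ofCone_mk_one f x
  left_inv := ind f (fun z => congrArg (ofCone f) (h.symm_apply_apply z)) fun _ => rfl
  right_inv := ind f (fun z => congrArg (ofCone f) (h.apply_symm_apply z)) fun _ => rfl
  continuous_toFun := ContinuousMap.continuous _
  continuous_invFun := ContinuousMap.continuous _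

/-- The straight homotopy of the interval from `t` to `min 1 (2 * t)`. -/
def stretchTime (τ t : I) : I :=
  ⟨(1 - τ : ℝ) * t + τ * min 1 (2 * (t : ℝ)), by
    have h0 := τ.2.1; have h1 := τ.2.2; have h2 := t.2.1
    exact add_nonneg (mul_nonneg (by linarith) h2)
      (mul_nonneg h0 (le_min zero_le_one (by linarith))), by
    have h0 := τ.2.1; have h1 := τ.2.2; have h2 := t.2.2
    have h3 : min 1 (2 * (t : ℝ)) ≤ 1 := min_le_left _ _
    nlinarith⟩

theorem stretchTime_zero_left (t : I) : stretchTime 0 t = t := Subtype.ext (by simp [stretchTime])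

theorem stretchTime_zero_right (τ : I) : stretchTime τ 0 = 0 := Subtype.ext (by simp [stretchTime])

theorem stretchTime_one_right (τ : I) : stretchTime τ 1 = 1 := Subtype.ext (by simp [stretchTime])

theorem stretchTime_one_left {t : I} (ht : 1 ≤ 2 * (t : ℝ)) : stretchTime 1 t = 1 :=
  Subtype.ext (by simp [stretchTime, ht])

theorem le_stretchTime (τ t : I) : (t : ℝ) ≤ stretchTime τ t := by
  have h : (t : ℝ) ≤ min 1 (2 * (t : ℝ)) := le_min t.2.2 (by linarith [t.2.1])
  have h' := mul_le_mul_of_nonneg_left h τ.2.1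
  change (t : ℝ) ≤ (1 - τ) * t + τ * min 1 (2 * (t : ℝ))
  linarith

/-- The track of the points of the cone under `stretch`, with the time as last variable. -/
def stretchCone : C((X × I) × I, TopMapCone f) where
  toFun p := ofCone f (TopCone.mk p.1.1 (stretchTime p.2 p.1.2))
  continuous_toFun := by
    have h : Continuous fun p : (X × I) × I => stretchTime p.2 p.1.2 :=
      Continuous.subtype_mk (by fun_prop) _
    exact (continuous_ofCone f).comp
      (TopCone.continuous_mk.comp ((continuous_fst.comp continuous_fst).prodMk h))

/-- The homotopy of the mapping cone that moves the points of the cone along the rays through the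
apex by `stretchTime`, and fixes the target. At time one, the outer half of the cone has been pushed
into the target. -/
def stretch : C(I × TopMapCone f, TopMapCone f) :=
  let H : C(TopMapCone f, C(I, TopMapCone f)) := lift
    (TopCone.lift (stretchCone f).curry
      (ContinuousMap.const _ (ofCone f (TopCone.apex X))) (fun x => by
        ext τ
        change ofCone f (TopCone.mk x (stretchTime τ 0)) = _
        rw [stretchTime_zero_right, TopCone.mk_zero]
        rfl))
    (ContinuousMap.curry ⟨fun p : Y × I => ofTarget f p.1,
      (continuous_ofTarget f).comp continuous_fst⟩) (fun x => by
        ext τ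
        change ofCone f (TopCone.mk x (stretchTime τ 1)) = ofTarget f (f x)
        rw [stretchTime_one_right, ofCone_mk_one])
  H.uncurry.comp (ContinuousMap.prodSwap)

theorem stretch_apex (τ : I) :
    stretch f (τ, ofCone f (TopCone.apex X)) = ofCone f (TopCone.apex X) := rfl

theorem stretch_mk (τ : I) (x : X) (t : I) : stretch f (τ, ofCone f (TopCone.mk x t)) =
    ofCone f (TopCone.mk x (stretchTime τ t)) := rfl

theorem stretch_ofTarget (τ : I) (y : Y) : stretch f (τ, ofTarget f y) = ofTarget f y := rfl

theorem stretch_zero (p : TopMapCone f) : stretch f (0, p) = p := by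
  induction p using ind with
  | h z =>
    induction z using TopCone.ind with
    | h0 => exact stretch_apex f 0
    | h x t => rw [stretch_mk, stretchTime_zero_left]
  | h' y => exact stretch_ofTarget f 0 y

end TopMapCone

/-! ### Splitting a point of a simplex at a level -/

section Splitting

variable {V : Type*} [Fintype V] [LinearOrder V]

/-- The top part of mass `s` of a system of weights `x` on a finite linear order: the mass is taken
from the largest vertices on. The vertex `v` occupies the interval between the total weight of the
vertices above `v` and the total weight of the vertices from `v` on, and the part of this interval
below `s` belongs to the top part. For `s ≥ ∑ v, x v` this is `x`. -/
def topPart (x : V → ℝ) (s : ℝ) (v : V) : ℝ :=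
  min s (∑ u with v ≤ u, x u) - min s (∑ u with v < u, x u)

theorem sum_ge_eq (x : V → ℝ) (v : V) : ∑ u with v ≤ u, x u = ∑ u with v < u, x u + x v := by
  have : (Finset.univ.filter fun u => v ≤ u) = insert v (Finset.univ.filter fun u => v < u) := by
    ext u
    simp [le_iff_eq_or_lt, eq_comm]
  rw [this, Finset.sum_insert (by simp), add_comm]

/-- A telescoping sum: along an upper set, the increments of `min s` over the intervals occupied by
the vertices add up. -/
theorem sum_topPart_of_isUpperSet {x : V → ℝ} {s : ℝ} (hs : 0 ≤ s) (S : Finset V)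
    (hS : IsUpperSet (S : Set V)) : ∑ v ∈ S, topPart x s v = min s (∑ v ∈ S, x v) := by
  have key : ∀ T : Finset V,
      ∑ v ∈ T, (min s (∑ u ∈ T with v ≤ u, x u) - min s (∑ u ∈ T with v < u, x u)) =
        min s (∑ v ∈ T, x v) := by
    intro T
    induction T using Finset.induction_on_min with
    | empty => simp [hs]
    | insert a T ha ih =>
      have haT : a ∉ T := fun h => lt_irrefl a (ha a h)
      rw [Finset.sum_insert haT]
      have e1 : ∀ v ∈ T, (insert a T).filter (v ≤ ·) = T.filter (v ≤ ·) := fun v hv => by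
        rw [Finset.filter_insert, if_neg (not_le.2 (ha v hv))]
      have e2 : ∀ v ∈ T, (insert a T).filter (v < ·) = T.filter (v < ·) := fun v hv => by
        rw [Finset.filter_insert, if_neg (not_lt.2 (ha v hv).le)]
      have e3 : (insert a T).filter (a ≤ ·) = insert a T := Finset.filter_true_of_mem fun u hu => by
        rcases Finset.mem_insert.1 hu with rfl | hu
        exacts [le_rfl, (ha u hu).le]
      have e4 : (insert a T).filter (a < ·) = T := by
        rw [Finset.filter_insert, if_neg (lt_irrefl a), Finset.filter_true_of_mem ha]
      have e5 : ∀ v ∈ T, min s (∑ u ∈ insert a T with v ≤ u, x u) -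
          min s (∑ u ∈ insert a T with v < u, x u) =
            min s (∑ u ∈ T with v ≤ u, x u) - min s (∑ u ∈ T with v < u, x u) := fun v hv => by
        rw [e1 v hv, e2 v hv]
      rw [Finset.sum_congr rfl e5, ih, e3, e4]
      ring
  rw [← key S]
  refine Finset.sum_congr rfl fun v hv => ?_
  have e1 : S.filter (v ≤ ·) = Finset.univ.filter (v ≤ ·) := by
    ext u
    simpa using fun h => hS h hv
  have e2 : S.filter (v < ·) = Finset.univ.filter (v < ·) := by
    ext u
    simpa using fun h => hS (le_of_lt h) hv
  rw [e1, e2, topPart]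

theorem sum_topPart {x : V → ℝ} {s : ℝ} (hs : 0 ≤ s) : ∑ v, topPart x s v = min s (∑ v, x v) :=
  sum_topPart_of_isUpperSet hs _ (by simp [isUpperSet_univ])

theorem sum_topPart_ge {x : V → ℝ} {s : ℝ} (hs : 0 ≤ s) (v : V) :
    ∑ u with v ≤ u, topPart x s u = min s (∑ u with v ≤ u, x u) :=
  sum_topPart_of_isUpperSet hs _ fun a b hab ha => by
    simp only [Finset.coe_filter, Finset.mem_univ, true_and, Set.mem_ofPred_eq] at ha ⊢
    exact ha.trans hab

theorem sum_topPart_gt {x : V → ℝ} {s : ℝ} (hs : 0 ≤ s) (v : V) :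
    ∑ u with v < u, topPart x s u = min s (∑ u with v < u, x u) :=
  sum_topPart_of_isUpperSet hs _ fun a b hab ha => by
    simp only [Finset.coe_filter, Finset.mem_univ, true_and, Set.mem_ofPred_eq] at ha ⊢
    exact lt_of_lt_of_le ha hab

theorem topPart_nonneg {x : V → ℝ} (hx : ∀ v, 0 ≤ x v) (s : ℝ) (v : V) : 0 ≤ topPart x s v := by
  rw [topPart, sum_ge_eq, sub_nonneg]
  exact min_le_min_left _ (by linarith [hx v])

theorem topPart_le {x : V → ℝ} (hx : ∀ v, 0 ≤ x v) (s : ℝ) (v : V) : topPart x s v ≤ x v := by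
  rw [topPart, sum_ge_eq, sub_le_iff_le_add]
  have := hx v
  rcases le_total s (∑ u with v < u, x u) with h | h
  · rw [min_eq_left h]
    exact (min_le_left _ _).trans (by linarith)
  · rw [min_eq_right h]
    exact (min_le_right _ _).trans (by linarith)

theorem topPart_zero {x : V → ℝ} (hx : ∀ v, 0 ≤ x v) : topPart x 0 = 0 := by
  funext v
  rw [topPart, min_eq_left (Finset.sum_nonneg fun u _ => hx u),
    min_eq_left (Finset.sum_nonneg fun u _ => hx u)]
  simp

theorem topPart_of_sum_le {x : V → ℝ} (hx : ∀ v, 0 ≤ x v) {s : ℝ} (hs : ∑ v, x v ≤ s) :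
    topPart x s = x := by
  funext v
  have h : ∀ S : Finset V, ∑ v ∈ S, x v ≤ s := fun S =>
    (Finset.sum_le_sum_of_subset_of_nonneg S.subset_univ fun u _ _ => hx u).trans hs
  rw [topPart, min_eq_right (h _), min_eq_right (h _), sum_ge_eq]
  ring

/-- The top part can be split off in two steps, and the second step sees only what the first one has
left. -/
theorem topPart_eq_add {x : V → ℝ} {s s' : ℝ} (hs : 0 ≤ s) (hss : s ≤ s') :
    topPart x s' = topPart x s + topPart (x - topPart x s) (s' - s) := by
  have key : ∀ a : ℝ, min (s' - s) (a - min s a) = min s' a - min s a := fun a => by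
    rcases le_total s a with h | h
    · rw [min_eq_left h, min_sub_sub_right]
    · rw [min_eq_right h, min_eq_right (h.trans hss), sub_self, min_eq_right (by linarith)]
  funext v
  simp only [Pi.add_apply]
  rw [topPart, topPart, topPart]
  simp only [Pi.sub_apply, Finset.sum_sub_distrib]
  rw [sum_topPart_ge hs, sum_topPart_gt hs, key, key]
  ring

/-- The top part is characterized by its mass and by lying above the rest. -/
theorem topPart_add_eq_right {w w' : V → ℝ} (hw : ∀ v, 0 ≤ w v) (hw' : ∀ v, 0 ≤ w' v) (k : V)
    (hk : ∀ v, w v ≠ 0 → v ≤ k) (hk' : ∀ v, w' v ≠ 0 → k ≤ v) :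
    topPart (w + w') (∑ v, w' v) = w' := by
  have low : ∀ S : Finset V, (∀ v ∈ S, k < v) → ∑ v ∈ S, (w + w') v ≤ ∑ v, w' v := by
    intro S hS
    rw [Finset.sum_congr rfl fun v hv => ?_]
    · exact Finset.sum_le_sum_of_subset_of_nonneg S.subset_univ fun v _ _ => hw' v
    · by_contra h
      exact not_le.2 (hS v hv) (hk v fun h0 => h (by simp [h0]))
  have high : ∀ S : Finset V, (∀ v, k ≤ v → v ∈ S) → ∑ v, w' v ≤ ∑ v ∈ S, (w + w') v := by
    intro S hS
    rw [← Finset.sum_subset S.subset_univ fun v _ hv => ?_]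
    · exact Finset.sum_le_sum fun v _ => by simp [hw v]
    · by_contra h
      exact hv (hS v (hk' v h))
  funext v
  rcases lt_trichotomy v k with h | rfl | h
  · rw [topPart, min_eq_left (high _ fun u hu => by simp [h.le.trans hu]),
      min_eq_left (high _ fun u hu => by simp [h.trans_le hu]), sub_self]
    by_contra h'
    exact not_le.2 h (hk' v (Ne.symm h'))
  · rw [topPart, min_eq_left (high _ fun u hu => by simpa using hu),
      min_eq_right (low _ fun u hu => by simpa using hu)]
    have e : ∑ u, w' u = ∑ u with v ≤ u, w' u :=
      (Finset.sum_subset (Finset.subset_univ _) fun u _ hu => by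
        by_contra h
        exact hu (by simpa using hk' u h)).symm
    have e' : ∑ u with v < u, (w + w') u = ∑ u with v < u, w' u :=
      Finset.sum_congr rfl fun u hu => by
        by_contra h
        exact not_le.2 (Finset.mem_filter.1 hu).2 (hk u fun h0 => h (by simp [h0]))
    rw [e, e', sum_ge_eq]
    ring
  · rw [topPart, min_eq_right (low _ fun u hu => lt_of_lt_of_le h (by simpa using hu)),
      min_eq_right (low _ fun u hu => h.trans (by simpa using hu)), sum_ge_eq]
    have : w v = 0 := by
      by_contra h'
      exact not_le.2 h (hk v h')
    simp [this]

theorem le_of_topPart_ne_zero {x : V → ℝ} (hx : ∀ v, 0 ≤ x v) {s : ℝ} {u v : V}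
    (hu : x u - topPart x s u ≠ 0) (hv : topPart x s v ≠ 0) : u ≤ v := by
  by_contra! h
  have h1 : s < ∑ w with u ≤ w, x w := by
    by_contra! h1
    refine hu ?_
    have := hx u
    rw [sum_ge_eq] at h1
    rw [topPart, sum_ge_eq, min_eq_right h1, min_eq_right (by linarith)]
    ring
  have h2 : ∑ w with v < w, x w < s := by
    by_contra! h2
    refine hv ?_
    have := hx v
    rw [topPart, sum_ge_eq, min_eq_left h2, min_eq_left (by linarith), sub_self]
  have h3 : ∑ w with u ≤ w, x w ≤ ∑ w with v < w, x w :=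
    Finset.sum_le_sum_of_subset_of_nonneg (fun w hw => by
      simp only [Finset.mem_filter, Finset.mem_univ, true_and] at hw ⊢
      exact h.trans_le hw) fun w _ _ => hx w
  linarith

/-- The two parts of a point of a simplex lie on a simplex of the prism. -/
theorem exists_splitting_vertex {x : V → ℝ} (hx : ∀ v, 0 ≤ x v) (hne : ∃ v, x v ≠ 0) (s : ℝ) :
    ∃ k, x k ≠ 0 ∧ (∀ v, x v - topPart x s v ≠ 0 → v ≤ k) ∧ ∀ v, topPart x s v ≠ 0 → k ≤ v := by
  by_cases h : ∃ v, x v - topPart x s v ≠ 0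
  · have hS : (Finset.univ.filter fun v => x v - topPart x s v ≠ 0).Nonempty :=
      h.imp fun v hv => by simpa using hv
    have hk := Finset.max'_mem _ hS
    rw [Finset.mem_filter] at hk
    refine ⟨_, fun h0 => hk.2 ?_, fun v hv => Finset.le_max' _ _ (by simpa using hv),
      fun v hv => le_of_topPart_ne_zero hx hk.2 hv⟩
    have h1 := topPart_nonneg hx s (Finset.max' _ hS)
    have h2 := topPart_le hx s (Finset.max' _ hS)
    linarith
  · push Not at h
    have hS : (Finset.univ.filter fun v => x v ≠ 0).Nonempty :=
      hne.imp fun v hv => by simpa using hv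
    have hk := Finset.min'_mem _ hS
    rw [Finset.mem_filter] at hk
    refine ⟨_, hk.2, fun v hv => absurd (h v) hv, fun v hv => Finset.min'_le _ _ ?_⟩
    rw [Finset.mem_filter]
    exact ⟨Finset.mem_univ v, fun h0 => hv (by linarith [h v])⟩

theorem continuous_topPart : Continuous fun p : (V → ℝ) × ℝ => topPart p.1 p.2 := by
  unfold topPart
  fun_prop

end Splitting

/-! ### The cone on a realization and the realization of the simplicial cone -/

section ConeWeight

variable {V : Type*} [Fintype V] [LinearOrder V]

/-- The barycentric coordinates, in the simplicial cone, of the point of the topological cone given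
by the point with barycentric coordinates `x` and by the time `t`. The inner half of the topological
cone, `t ≤ 1 / 2`, is the cone on the inner layer, and the outer half is the product `A × I`, where
the top part of `x` of mass `2 * t - 1` is moved to the outer layer. -/
def coneWeight (x : V → ℝ) (t : ℝ) : Option (V × Fin 2) → ℝ
  | none => max 0 (1 - 2 * t)
  | some (v, i) => if i = 0 then min 1 (2 * t) * x v - topPart x (max 0 (2 * t - 1)) v
      else topPart x (max 0 (2 * t - 1)) v

@[simp]
theorem coneWeight_none (x : V → ℝ) (t : ℝ) : coneWeight x t none = max 0 (1 - 2 * t) := rfl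

@[simp]
theorem coneWeight_inner (x : V → ℝ) (t : ℝ) (v : V) : coneWeight x t (some (v, 0)) =
    min 1 (2 * t) * x v - topPart x (max 0 (2 * t - 1)) v := rfl

@[simp]
theorem coneWeight_outer (x : V → ℝ) (t : ℝ) (v : V) : coneWeight x t (some (v, 1)) =
    topPart x (max 0 (2 * t - 1)) v := rfl

theorem coneWeight_of_le {x : V → ℝ} (hx : ∀ v, 0 ≤ x v) {t : ℝ} (ht : 2 * t ≤ 1) :
    max 0 (1 - 2 * t) = 1 - 2 * t ∧ min 1 (2 * t) = 2 * t ∧ topPart x (max 0 (2 * t - 1)) = 0 := by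
  rw [max_eq_right (by linarith), min_eq_right ht, max_eq_left (by linarith), topPart_zero hx]
  exact ⟨rfl, rfl, rfl⟩

theorem coneWeight_of_ge {t : ℝ} (ht : 1 ≤ 2 * t) :
    max 0 (1 - 2 * t) = 0 ∧ min 1 (2 * t) = 1 ∧ max 0 (2 * t - 1) = 2 * t - 1 := by
  rw [max_eq_left (by linarith), min_eq_left ht, max_eq_right (by linarith)]
  exact ⟨rfl, rfl, rfl⟩

theorem coneWeight_nonneg {x : V → ℝ} (hx : ∀ v, 0 ≤ x v) {t : ℝ} (ht : 0 ≤ t)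
    (p : Option (V × Fin 2)) : 0 ≤ coneWeight x t p := by
  rcases p with _ | ⟨v, i⟩
  · exact le_max_left _ _
  · fin_cases i
    · simp only [Fin.zero_eta, coneWeight_inner, sub_nonneg]
      rcases le_total (2 * t) 1 with h | h
      · rw [(coneWeight_of_le hx h).2.1, (coneWeight_of_le hx h).2.2]
        exact mul_nonneg (by linarith) (hx v)
      · rw [(coneWeight_of_ge h).2.1, one_mul]
        exact topPart_le hx _ v
    · exact topPart_nonneg hx _ v

omit [LinearOrder V] in
theorem sum_option_prod_fin_two (w : Option (V × Fin 2) → ℝ) :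
    ∑ p, w p = w none + (∑ v, w (some (v, 0)) + ∑ v, w (some (v, 1))) := by
  rw [Fintype.sum_option, Fintype.sum_prod_type]
  simp [Fin.sum_univ_two, Finset.sum_add_distrib]

theorem sum_coneWeight_outer {x : V → ℝ} (hx1 : ∑ v, x v = 1) {t : ℝ} (ht : t ≤ 1) :
    ∑ v, coneWeight x t (some (v, 1)) = max 0 (2 * t - 1) := by
  simp only [coneWeight_outer]
  rw [sum_topPart (le_max_left _ _), hx1, min_eq_left (max_le zero_le_one (by linarith))]

theorem sum_coneWeight {x : V → ℝ} (hx1 : ∑ v, x v = 1) {t : ℝ} (ht : t ≤ 1) :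
    ∑ p, coneWeight x t p = 1 := by
  have h := sum_coneWeight_outer hx1 ht
  rw [sum_option_prod_fin_two, h]
  simp only [coneWeight_outer] at h
  simp only [coneWeight_inner, coneWeight_none, Finset.sum_sub_distrib, h, ← Finset.mul_sum, hx1]
  rcases le_total (2 * t) 1 with h | h
  · rw [max_eq_right (by linarith), min_eq_right h]
    ring
  · rw [max_eq_left (by linarith), min_eq_left h]
    ring

theorem insert_none_image_mem_coneOff {U : Type*} [DecidableEq U]
    (A S : PreAbstractSimplicialComplex U) {s : Finset U} (hs : s = ∅ ∨ s ∈ S.faces) :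
    insert none (s.image some) ∈ (coneOff A S).faces := by
  refine Or.inr ⟨Finset.insert_nonempty _ _, ?_⟩
  have : (insert none (s.image some)).eraseNone = s := by
    ext
    simp
  rwa [this]

theorem coneWeight_mem {A : AbstractSimplicialComplex V} {x : V → ℝ} (hx : x ∈ weightSpace A)
    {t : ℝ} (ht0 : 0 ≤ t) (ht1 : t ≤ 1) : coneWeight x t ∈ weightSpace (simpCone A) := by
  obtain ⟨h0, h1, h2⟩ := hx
  rcases le_total (2 * t) 1 with h | h
  · refine mem_weightSpace_of_subset (coneWeight_nonneg h0 ht0) (sum_coneWeight h1 ht1)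
      (insert_none_image_mem_coneOff _ _ (Or.inr ⟨_, h2, rfl⟩)) ?_
    rintro (_ | ⟨v, i⟩) hp
    · simp
    · fin_cases i
      · simp only [Fin.zero_eta, coneWeight_inner, (coneWeight_of_le h0 h).2.2, Pi.zero_apply,
          sub_zero] at hp
        simp [right_ne_zero_of_mul hp]
      · simp [(coneWeight_of_le h0 h).2.2] at hp
  · have hne : ∃ v, x v ≠ 0 := by
      by_contra! hz
      simp [hz] at h1
    obtain ⟨k, hk, hk1, hk2⟩ := exists_splitting_vertex h0 hne (max 0 (2 * t - 1))
    let P := prismSimplex (Finset.univ.filter fun v => x v ≠ 0) k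
    have hkP : (k, 0) ∈ P := by simp [P, prismSimplex, hk]
    have hP : P ∈ (simpProd A).faces :=
      ⟨⟨_, hkP⟩, _, h2, k, by simpa using hk, subset_rfl⟩
    refine mem_weightSpace_of_subset (coneWeight_nonneg h0 ht0) (sum_coneWeight h1 ht1)
      (s := P.image some) (Or.inl ⟨P, hP, rfl⟩) ?_
    rintro (_ | ⟨v, i⟩) hp
    · exact absurd (coneWeight_of_ge h).1 hp
    · have hT0 := topPart_nonneg h0 (max 0 (2 * t - 1)) v
      have hT1 := topPart_le h0 (max 0 (2 * t - 1)) v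
      fin_cases i
      · simp only [Fin.zero_eta, coneWeight_inner, (coneWeight_of_ge h).2.1, one_mul] at hp
        have : x v ≠ 0 := fun hz => hp (by linarith)
        simp [P, prismSimplex, hk1 v hp, this]
      · simp only [Fin.mk_one, coneWeight_outer] at hp
        have : x v ≠ 0 := fun hz => hp (by linarith)
        simp [P, prismSimplex, hk2 v hp, this]

/-- The barycentric coordinates of the apex of the simplicial cone. -/
def apexWeight (V : Type*) : Option (V × Fin 2) → ℝ
  | none => 1
  | some _ => 0

theorem apexWeight_mem (A : AbstractSimplicialComplex V) :
    apexWeight V ∈ weightSpace (simpCone A) := by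
  refine mem_weightSpace_of_subset (fun p => ?_) ?_ ((simpCone A).singleton_mem none) fun p hp => ?_
  · cases p <;> simp [apexWeight]
  · simp [apexWeight]
  · cases p
    · simp
    · exact absurd rfl hp

theorem coneWeight_zero {x : V → ℝ} (hx : ∀ v, 0 ≤ x v) : coneWeight x 0 = apexWeight V := by
  have h := coneWeight_of_le hx (t := 0) (by norm_num)
  funext p
  rcases p with _ | ⟨v, i⟩
  · simp [apexWeight]
  · fin_cases i <;> simp [apexWeight, topPart_zero hx]

theorem coneWeight_one {A : AbstractSimplicialComplex V} {x : V → ℝ} (hx : x ∈ weightSpace A) :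
    coneWeight x 1 = pushWeight (outerLayer A).toFun x := by
  have h : topPart x (max 0 (2 * 1 - 1)) = x := topPart_of_sum_le hx.1 (by norm_num [hx.2.1])
  funext p
  rcases p with _ | ⟨v, i⟩
  · simp [pushWeight, outerLayer]
  · fin_cases i <;> norm_num [pushWeight, outerLayer] at h ⊢ <;> simp [h]

theorem continuous_coneWeight : Continuous fun p : (V → ℝ) × ℝ => coneWeight p.1 p.2 := by
  have hT : ∀ v, Continuous fun p : (V → ℝ) × ℝ => topPart p.1 (max 0 (2 * p.2 - 1)) v := fun v =>
    (continuous_apply v).comp (continuous_topPart.comp (by fun_prop :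
      Continuous fun p : (V → ℝ) × ℝ => (p.1, max 0 (2 * p.2 - 1))))
  refine continuous_pi fun p => ?_
  rcases p with _ | ⟨v, i⟩
  · simp only [coneWeight_none]
    fun_prop
  · fin_cases i
    · exact (by fun_prop : Continuous fun p : (V → ℝ) × ℝ => min 1 (2 * p.2) * p.1 v).sub (hT v)
    · exact hT v

/-- The time of a point of the cone can be read off from the weights of the new vertex and of the
outer layer. -/
theorem time_eq_of_max_eq {t t' : ℝ} (h : max 0 (1 - 2 * t) = max 0 (1 - 2 * t'))
    (h' : max 0 (2 * t - 1) = max 0 (2 * t' - 1)) : t = t' := by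
  have key : ∀ t : ℝ, max 0 (2 * t - 1) - max 0 (1 - 2 * t) = 2 * t - 1 := fun t => by
    rcases le_total (2 * t) 1 with h | h
    · rw [max_eq_left (by linarith), max_eq_right (by linarith)]
      ring
    · rw [max_eq_right (by linarith), max_eq_left (by linarith)]
      ring
  linarith [key t, key t']

theorem coneWeight_injective {x x' : V → ℝ} (hx : ∑ v, x v = 1) (hx' : ∑ v, x' v = 1) {t t' : ℝ}
    (ht : t ≤ 1) (ht' : t' ≤ 1) (h : coneWeight x t = coneWeight x' t') :
    t = t' ∧ (0 < t → x = x') := by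
  have e : t = t' := time_eq_of_max_eq (congrFun h none) (by
    rw [← sum_coneWeight_outer hx ht, ← sum_coneWeight_outer hx' ht', h])
  refine ⟨e, fun hpos => funext fun v => ?_⟩
  subst e
  have h0 := congrFun h (some (v, 0))
  have h1 := congrFun h (some (v, 1))
  simp only [coneWeight_inner, coneWeight_outer] at h0 h1
  have hm : min 1 (2 * t) ≠ 0 := (lt_min one_pos (by linarith)).ne'
  exact mul_left_cancel₀ hm (by linarith)

/-- Every point of the simplicial cone is the apex or comes from a point of the topological cone. -/
theorem exists_coneWeight_eq {A : AbstractSimplicialComplex V} {u : Option (V × Fin 2) → ℝ}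
    (hu : u ∈ weightSpace (simpCone A)) :
    u = apexWeight V ∨ ∃ x ∈ weightSpace A, ∃ t : I, coneWeight x t = u := by
  obtain ⟨h0, h1, h2⟩ := hu
  rw [sum_option_prod_fin_two] at h1
  rcases h2 with ⟨P, ⟨-, S, hS, k, hk, hP⟩, hPu⟩ | ⟨-, hT⟩
  · -- A point of the product: both layers are read off, and the top part is the outer layer.
    have hmem : ∀ q, u (some q) ≠ 0 → q ∈ prismSimplex S k := fun q hq => hP (by
      have : some q ∈ P.image some := by
        rw [show P.image some = _ from hPu]
        simpa using hq
      simpa using this)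
    have hnone : u none = 0 := by
      by_contra h
      have : none ∈ P.image some := by
        rw [show P.image some = _ from hPu]
        simpa using h
      simp at this
    set w : V → ℝ := fun v => u (some (v, 0)) with hw
    set w' : V → ℝ := fun v => u (some (v, 1)) with hw'
    have hwk : ∀ v, w v ≠ 0 → v ∈ S ∧ v ≤ k := fun v hv => by
      simpa [prismSimplex] using hmem (v, 0) hv
    have hwk' : ∀ v, w' v ≠ 0 → v ∈ S ∧ k ≤ v := fun v hv => by
      simpa [prismSimplex] using hmem (v, 1) hv
    have hs0 : 0 ≤ ∑ v, w' v := Finset.sum_nonneg fun v _ => h0 _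
    have hs1 : 0 ≤ ∑ v, w v := Finset.sum_nonneg fun v _ => h0 _
    rw [hnone, zero_add] at h1
    have ht : 1 ≤ 2 * ((1 + ∑ v, w' v) / 2) := by linarith
    have hst : max 0 (2 * ((1 + ∑ v, w' v) / 2) - 1) = ∑ v, w' v := by
      rw [(coneWeight_of_ge ht).2.2]
      ring
    have htop : topPart (w + w') (∑ v, w' v) = w' :=
      topPart_add_eq_right (fun v => h0 _) (fun v => h0 _) k (fun v hv => (hwk v hv).2)
        fun v hv => (hwk' v hv).2
    refine Or.inr ⟨w + w', mem_weightSpace_of_subset (fun v => add_nonneg (h0 _) (h0 _))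
      (by simpa [Finset.sum_add_distrib] using h1) hS fun v hv => ?_,
      ⟨(1 + ∑ v, w' v) / 2, by linarith, by linarith⟩, ?_⟩
    · by_contra hvS
      refine hv ?_
      have e : w v = 0 := by
        by_contra h
        exact hvS (hwk v h).1
      have e' : w' v = 0 := by
        by_contra h
        exact hvS (hwk' v h).1
      simp [e, e']
    · funext p
      rcases p with _ | ⟨v, i⟩
      · rw [hnone]
        exact (coneWeight_of_ge ht).1
      · fin_cases i
        · change min 1 (2 * ((1 + ∑ v, w' v) / 2)) * (w + w') v - topPart _ _ v = w v
          rw [hst, htop, (coneWeight_of_ge ht).2.1]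
          simp
        · change topPart _ _ v = w' v
          rw [hst, htop]
  · -- A point of the cone on the inner layer: the inner weights are normalized.
    have hmem : ∀ q, u (some q) ≠ 0 → q ∈ Finset.eraseNone
        (Finset.univ.filter fun p => u p ≠ 0) := fun q hq => by simpa using hq
    rcases hT with hT | ⟨S, hS, hT⟩
    · have hz : ∀ q, u (some q) = 0 := fun q => by
        by_contra h
        simpa [hT] using hmem q h
      left
      funext p
      cases p with
      | none =>
        change u none = 1
        simpa [hz] using h1
      | some q => exact hz q
    · have hT' : ∀ v i, u (some (v, i)) ≠ 0 → v ∈ S ∧ i = 0 := fun v i h => by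
        have := hmem _ h
        rw [← show S.image (fun v => (v, (0 : Fin 2))) = _ from hT] at this
        simpa [eq_comm] using this
      have h1z : ∀ v, u (some (v, 1)) = 0 := fun v => by
        by_contra h
        exact one_ne_zero (hT' v 1 h).2
      simp only [h1z, Finset.sum_const_zero, add_zero] at h1
      set r := ∑ v, u (some (v, 0)) with hr
      have hr0 : 0 ≤ r := Finset.sum_nonneg fun v _ => h0 _
      have hn0 := h0 none
      rcases hr0.eq_or_lt with hr0 | hr0
      · have hz : ∀ v, u (some (v, 0)) = 0 := fun v =>
          (Finset.sum_eq_zero_iff_of_nonneg fun v _ => h0 _).1 (hr.symm.trans hr0.symm) v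
            (Finset.mem_univ v)
        left
        funext p
        rcases p with _ | ⟨v, i⟩
        · change u none = 1
          linarith
        · fin_cases i
          exacts [hz v, h1z v]
      · have hx0 : ∀ v, 0 ≤ u (some (v, 0)) / r := fun v => div_nonneg (h0 _) hr0.le
        have ht : 2 * (r / 2) ≤ 1 := by linarith
        have hcw := coneWeight_of_le hx0 ht
        refine Or.inr ⟨fun v => u (some (v, 0)) / r, mem_weightSpace_of_subset hx0
          (by rw [← Finset.sum_div, ← hr, div_self hr0.ne']) hS fun v hv => ?_,
          ⟨r / 2, by linarith, by linarith⟩, ?_⟩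
        · exact (hT' v 0 fun h => hv (by simp [h])).1
        · funext p
          rcases p with _ | ⟨v, i⟩
          · rw [coneWeight_none, hcw.1]
            linarith
          · fin_cases i
            · change min 1 (2 * (r / 2)) * (u (some (v, 0)) / r) - topPart _ _ v = u (some (v, 0))
              rw [hcw.2.1, hcw.2.2, Pi.zero_apply]
              field_simp
              ring
            · change topPart _ _ v = u (some (v, 1))
              rw [hcw.2.2, h1z, Pi.zero_apply]

end ConeWeight

section ConeHomeo

variable {V : Type*} [Fintype V] [LinearOrder V] {A : AbstractSimplicialComplex V} {a c : ℕ}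

/-- The map from the topological cone to the simplicial cone given by `coneWeight`. -/
noncomputable def coneMap (K : GeomRealization A a) (C : GeomRealization (simpCone A) c) :
    C(TopCone K.Space, C.Space) :=
  TopCone.lift
    ⟨fun p => C.coordHomeo.symm ⟨coneWeight (K.bary p.1) p.2,
        coneWeight_mem (K.bary_mem p.1) p.2.2.1 p.2.2.2⟩,
      C.coordHomeo.symm.continuous.comp (Continuous.subtype_mk (continuous_coneWeight.comp
        ((K.continuous_bary.comp continuous_fst).prodMk
          (continuous_subtype_val.comp continuous_snd))) _)⟩
    (C.coordHomeo.symm ⟨apexWeight V, apexWeight_mem A⟩)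
    (fun x => congrArg C.coordHomeo.symm (Subtype.ext (coneWeight_zero (K.bary_mem x).1)))

theorem bary_coneMap_mk (K : GeomRealization A a) (C : GeomRealization (simpCone A) c) (x : K.Space)
    (t : I) : C.bary (coneMap K C (TopCone.mk x t)) = coneWeight (K.bary x) t :=
  C.bary_coordHomeo_symm _

theorem bary_coneMap_apex (K : GeomRealization A a) (C : GeomRealization (simpCone A) c) :
    C.bary (coneMap K C (TopCone.apex _)) = apexWeight V :=
  C.bary_coordHomeo_symm _

theorem coneMap_mk_one (K : GeomRealization A a) (C : GeomRealization (simpCone A) c)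
    (x : K.Space) : coneMap K C (TopCone.mk x 1) = (outerLayer A).realize K C x := by
  apply C.bary_injective
  rw [bary_coneMap_mk, SimplicialMap.bary_realize]
  exact coneWeight_one (K.bary_mem x)

theorem coneMap_injective (K : GeomRealization A a) (C : GeomRealization (simpCone A) c) :
    Function.Injective (coneMap K C) := by
  have hapex : ∀ x t, coneMap K C (TopCone.apex _) = coneMap K C (TopCone.mk x t) →
      TopCone.apex _ = TopCone.mk x t := fun x t h => by
    rw [← TopCone.mk_zero x] at h ⊢
    have h' := congrArg C.bary h
    rw [bary_coneMap_mk, bary_coneMap_mk] at h'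
    have := (coneWeight_injective (K.bary_mem x).2.1 (K.bary_mem x).2.1 (by simp) t.2.2 h').1
    rw [Subtype.ext this]
  intro z z'
  induction z using TopCone.ind with
  | h0 =>
    induction z' using TopCone.ind with
    | h0 => exact fun _ => rfl
    | h x t => exact hapex x t
  | h x t =>
    induction z' using TopCone.ind with
    | h0 => exact fun h => (hapex x t h.symm).symm
    | h x' t' =>
      intro h
      have h' := congrArg C.bary h
      rw [bary_coneMap_mk, bary_coneMap_mk] at h'
      obtain ⟨e, hx⟩ := coneWeight_injective (K.bary_mem x).2.1 (K.bary_mem x').2.1 t.2.2 t'.2.2 h'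
      obtain rfl : t = t' := Subtype.ext e
      rcases t.2.1.eq_or_lt with h0 | h0
      · obtain rfl : 0 = t := Subtype.ext h0
        rw [TopCone.mk_zero, TopCone.mk_zero]
      · rw [K.bary_injective (hx h0)]

theorem coneMap_surjective (K : GeomRealization A a) (C : GeomRealization (simpCone A) c) :
    Function.Surjective (coneMap K C) := by
  intro y
  rcases exists_coneWeight_eq (C.bary_mem y) with h | ⟨x, hx, t, h⟩
  · exact ⟨TopCone.apex _, C.bary_injective (by rw [bary_coneMap_apex, h])⟩
  · exact ⟨TopCone.mk (K.coordHomeo.symm ⟨x, hx⟩) t, C.bary_injective (by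
      rw [bary_coneMap_mk, GeomRealization.bary_coordHomeo_symm, h])⟩

/-- The homeomorphism from the topological cone to the simplicial cone. -/
noncomputable def coneHomeo (K : GeomRealization A a) (C : GeomRealization (simpCone A) c) :
    TopCone K.Space ≃ₜ C.Space :=
  Continuous.homeoOfEquivCompactToT2
    (f := Equiv.ofBijective (coneMap K C) ⟨coneMap_injective K C, coneMap_surjective K C⟩)
    (coneMap K C).continuous

theorem coneHomeo_apply (K : GeomRealization A a) (C : GeomRealization (simpCone A) c)
    (z : TopCone K.Space) : coneHomeo K C z = coneMap K C z := rfl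

end ConeHomeo

/-! ### The comparison map of mapping cones -/

section Lifting

variable {V W : Type*} [Fintype V] [Fintype W] [DecidableEq W]

omit [Fintype W] in
theorem pushWeight_eq_sum_smul (g : V → W) (w : V → ℝ) (y : W) :
    pushWeight g w y = ∑ v, w v • (if g v = y then (1 : ℝ) else 0) := by
  simp [pushWeight]

theorem pushWeight_pushWeight {Z : Type*} [DecidableEq Z] (h : W → Z) (g : V → W) (w : V → ℝ) :
    pushWeight h (pushWeight g w) = pushWeight (h ∘ g) w := by
  funext z
  rw [pushWeight_eq_sum_smul, pushWeight_eq_sum_smul, sum_pushWeight_smul]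
  rfl

omit [Fintype W] in
theorem pushWeight_apply_of_injective {g : V → W} (hg : Function.Injective g) (w : V → ℝ) (v : V) :
    pushWeight g w (g v) = w v := by
  classical
  simp [pushWeight, hg.eq_iff]

omit [Fintype W] in
theorem pushWeight_injective {g : V → W} (hg : Function.Injective g) :
    Function.Injective (pushWeight g) := fun w w' h => funext fun v => by
  rw [← pushWeight_apply_of_injective hg w, h, pushWeight_apply_of_injective hg]

/-- Weights on the image of a simplex lift to the simplex: the weight of each vertex of the image is
given to one of its preimages. -/
theorem exists_pushWeight_eq {A : AbstractSimplicialComplex V} {g : V → W} {u : W → ℝ}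
    (h0 : ∀ y, 0 ≤ u y) (h1 : ∑ y, u y = 1) {T : Finset V} (hT : T ∈ A.faces)
    (hu : ∀ y, u y ≠ 0 → y ∈ T.image g) : ∃ w ∈ weightSpace A, pushWeight g w = u := by
  classical
  have hc : ∀ y, ∃ v, u y ≠ 0 → v ∈ T ∧ g v = y := fun y => by
    by_cases hy : u y = 0
    · exact ⟨((A.isRelLowerSet_faces hT).1).choose, fun h => absurd hy h⟩
    · obtain ⟨v, hv⟩ := Finset.mem_image.1 (hu y hy)
      exact ⟨v, fun _ => hv⟩
  choose r hr using hc
  have hpush : pushWeight g (pushWeight r u) = u := by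
    rw [pushWeight_pushWeight]
    funext y
    rw [pushWeight, Finset.sum_eq_single y]
    · by_cases hy : u y = 0
      · simp [hy]
      · simp [(hr y hy).2]
    · intro z _ hzy
      by_cases hz : u z = 0
      · simp [hz]
      · simp [(hr z hz).2, hzy]
    · simp
  refine ⟨pushWeight r u, mem_weightSpace_of_subset (pushWeight_nonneg h0)
    ((sum_pushWeight _ _).trans h1) hT fun v hv => ?_, hpush⟩
  obtain ⟨y, rfl, hy⟩ := exists_of_pushWeight_ne_zero hv
  exact (hr y hy).1

theorem SimplicialMap.exists_realize_eq {A : AbstractSimplicialComplex V}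
    {B : AbstractSimplicialComplex W} {n m : ℕ} (f : SimplicialMap A B) (K : GeomRealization A n)
    (L : GeomRealization B m) (y : L.Space) {T : Finset V} (hT : T ∈ A.faces)
    (hy : (Finset.univ.filter fun w => L.bary y w ≠ 0) = T.image f.toFun) :
    ∃ x, f.realize K L x = y := by
  obtain ⟨w, hw, hwy⟩ := exists_pushWeight_eq (L.bary_mem y).1 (L.bary_mem y).2.1 hT
    (g := f.toFun) fun v hv => by rw [← hy]; simpa using hv
  exact ⟨K.coordHomeo.symm ⟨w, hw⟩, L.bary_injective (by
    rw [SimplicialMap.bary_realize, GeomRealization.bary_coordHomeo_symm, hwy])⟩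

theorem SimplicialMap.realize_injective {A : AbstractSimplicialComplex V}
    {B : AbstractSimplicialComplex W} {n m : ℕ} {f : SimplicialMap A B}
    (hf : Function.Injective f.toFun) (K : GeomRealization A n) (L : GeomRealization B m) :
    Function.Injective (f.realize K L) := fun x x' h => by
  apply K.bary_injective
  apply pushWeight_injective hf
  rw [← f.bary_realize K L, ← f.bary_realize K L, h]

end Lifting

section MapCone

variable {V W : Type*} [LinearOrder V] [DecidableEq W] {A : AbstractSimplicialComplex V}
  {B : AbstractSimplicialComplex W}

omit [LinearOrder V] in
@[simp]
theorem cylVertex_zero (f : SimplicialMap A B) (v : V) : cylVertex f (v, 0) = Sum.inl v := rfl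

omit [LinearOrder V] in
@[simp]
theorem cylVertex_one (f : SimplicialMap A B) (v : V) :
    cylVertex f (v, 1) = Sum.inr (f.toFun v) := rfl

/-- The simplicial mapping cone is covered by the images of the simplicial cone and of the
target. -/
theorem exists_of_mem_simpMapCone {f : SimplicialMap A B} {T : Finset (Option (V ⊕ W))}
    (hT : T ∈ (simpMapCone f).faces) :
    (∃ P ∈ (simpCone A).faces, T = P.image (coneQuotient f).toFun) ∨
      ∃ b ∈ B.faces, T = b.image (targetInclusion f).toFun := by
  rcases hT with ⟨P', ⟨P, hP, rfl⟩ | ⟨b, hb, rfl⟩, rfl⟩ | ⟨hne, hT⟩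
  · refine Or.inl ⟨P.image some, Or.inl ⟨P, hP, rfl⟩, ?_⟩
    simp only [Finset.image_image]
    rfl
  · refine Or.inr ⟨b, hb, ?_⟩
    simp only [Finset.image_image]
    rfl
  · obtain ⟨S, hS, hTS⟩ : ∃ S : Finset V, (S = ∅ ∨ S ∈ A.faces) ∧
        T.eraseNone = S.image Sum.inl := by
      rcases hT with hT | ⟨S, hS, hT⟩
      exacts [⟨∅, Or.inl rfl, hT⟩, ⟨S, Or.inr hS, hT.symm⟩]
    -- The inner layer is embedded, so a simplex on the new vertex lifts to the simplicial cone.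
    let P : Finset (Option (V × Fin 2)) :=
      (T.filter (· = none)).image (fun _ => none) ∪ S.image fun v => some (v, 0)
    have hPT : T = P.image (coneQuotient f).toFun := by
      have h1 : (coneQuotient f).toFun ∘ (fun _ : Option (V ⊕ W) => none) = fun _ => none := rfl
      have h2 : (coneQuotient f).toFun ∘ (fun v : V => some (v, (0 : Fin 2))) =
        some ∘ Sum.inl := rfl
      rw [Finset.image_union, Finset.image_image, Finset.image_image, h1, h2,
        ← Finset.image_image, ← hTS]
      ext p
      cases p <;> simp
    have hPne : P.Nonempty := by
      rw [hPT] at hne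
      exact Finset.image_nonempty.1 hne
    have hPS : P.eraseNone = S.image fun v => (v, 0) := by
      ext p
      simp [P]
    refine Or.inl ⟨P, Or.inr ⟨hPne, ?_⟩, hPT⟩
    rw [hPS]
    rcases hS with rfl | hS
    exacts [Or.inl rfl, Or.inr ⟨S, hS, rfl⟩]

variable [Fintype V] [Fintype W]

omit [Fintype W] in
theorem pushWeight_coneQuotient_none (f : SimplicialMap A B) (u : Option (V × Fin 2) → ℝ) :
    pushWeight (coneQuotient f).toFun u none = u none := by
  simp [pushWeight, coneQuotient]

omit [Fintype W] in
theorem pushWeight_coneQuotient_inl (f : SimplicialMap A B) (u : Option (V × Fin 2) → ℝ) (v : V) :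
    pushWeight (coneQuotient f).toFun u (some (Sum.inl v)) = u (some (v, 0)) := by
  simp [pushWeight, coneQuotient]

omit [Fintype W] in
theorem pushWeight_coneQuotient_inr (f : SimplicialMap A B) (u : Option (V × Fin 2) → ℝ) (w : W) :
    pushWeight (coneQuotient f).toFun u (some (Sum.inr w)) =
      pushWeight f.toFun (fun v => u (some (v, 1))) w := by
  simp [pushWeight, coneQuotient, Fintype.sum_prod_type, Fin.sum_univ_two]

omit [Fintype V] [Fintype W] in
theorem targetInclusion_injective (f : SimplicialMap A B) :
    Function.Injective (targetInclusion f).toFun :=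
  (Option.some_injective _).comp Sum.inr_injective

/-- The barycentric coordinates, in the simplicial mapping cone, of the image of a point of the
topological cone. -/
def mapConeWeight (f : SimplicialMap A B) (x : V → ℝ) (t : ℝ) : Option (V ⊕ W) → ℝ :=
  pushWeight (coneQuotient f).toFun (coneWeight x t)

omit [Fintype W] in
/-- Two points of the cone at the same time have the same image if and only if the parts left on
the inner layer agree, and the parts on the outer layer have the same image in the target. -/
theorem mapConeWeight_eq_iff {f : SimplicialMap A B} {x x' : V → ℝ} {t : ℝ} :
    mapConeWeight f x t = mapConeWeight f x' t ↔
      (∀ v, min 1 (2 * t) * x v - topPart x (max 0 (2 * t - 1)) v =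
        min 1 (2 * t) * x' v - topPart x' (max 0 (2 * t - 1)) v) ∧
      pushWeight f.toFun (topPart x (max 0 (2 * t - 1))) =
        pushWeight f.toFun (topPart x' (max 0 (2 * t - 1))) := by
  simp only [mapConeWeight]
  constructor
  · intro h
    refine ⟨fun v => ?_, funext fun w => ?_⟩
    · have := congrFun h (some (Sum.inl v))
      simpa only [pushWeight_coneQuotient_inl, coneWeight_inner] using this
    · have := congrFun h (some (Sum.inr w))
      simpa only [pushWeight_coneQuotient_inr, coneWeight_outer] using this
  · rintro ⟨h, h'⟩
    funext p
    rcases p with _ | v | w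
    · simp only [pushWeight_coneQuotient_none, coneWeight_none]
    · simpa only [pushWeight_coneQuotient_inl, coneWeight_inner] using h v
    · simpa only [pushWeight_coneQuotient_inr, coneWeight_outer] using congrFun h' w

theorem time_eq_of_mapConeWeight_eq {f : SimplicialMap A B} {x x' : V → ℝ} (hx : ∑ v, x v = 1)
    (hx' : ∑ v, x' v = 1) {t t' : ℝ} (ht : t ≤ 1) (ht' : t' ≤ 1)
    (h : mapConeWeight f x t = mapConeWeight f x' t') : t = t' := by
  refine time_eq_of_max_eq ?_ ?_
  · have := congrFun h none
    simpa only [mapConeWeight, pushWeight_coneQuotient_none, coneWeight_none] using this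
  · have key : ∀ (x : V → ℝ) (t : ℝ), ∑ w, mapConeWeight f x t (some (Sum.inr w)) =
        ∑ v, coneWeight x t (some (v, 1)) := fun x t => by
      simp only [mapConeWeight, pushWeight_coneQuotient_inr]
      exact sum_pushWeight _ _
    rw [← sum_coneWeight_outer hx ht, ← sum_coneWeight_outer hx' ht', ← key, ← key, h]

omit [Fintype W] in
/-- On the outer half of the cone, having the same image persists when the time increases: the
further mass moved to the outer layer is determined by the part left on the inner layer. -/
theorem mapConeWeight_eq_of_le {f : SimplicialMap A B} {x x' : V → ℝ} {t t' : ℝ} (ht : 1 ≤ 2 * t)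
    (htt : t ≤ t') (h : mapConeWeight f x t = mapConeWeight f x' t) :
    mapConeWeight f x t' = mapConeWeight f x' t' := by
  rw [mapConeWeight_eq_iff] at h ⊢
  have ht' : 1 ≤ 2 * t' := by linarith
  simp only [(coneWeight_of_ge ht).2.1, (coneWeight_of_ge ht).2.2, (coneWeight_of_ge ht').2.1,
    (coneWeight_of_ge ht').2.2, one_mul] at h ⊢
  obtain ⟨h1, h2⟩ := h
  have h1' : x - topPart x (2 * t - 1) = x' - topPart x' (2 * t - 1) := funext h1
  have key := fun x : V → ℝ => topPart_eq_add (x := x) (s := 2 * t - 1) (s' := 2 * t' - 1)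
    (by linarith) (by linarith)
  rw [key x, key x', pushWeight_add, pushWeight_add, h2, h1']
  refine ⟨fun v => ?_, rfl⟩
  have := h1 v
  simp only [Pi.add_apply]
  linarith

variable {a b c d : ℕ} (f : SimplicialMap A B) (K : GeomRealization A a) (L : GeomRealization B b)
  (C : GeomRealization (simpCone A) c) (M : GeomRealization (simpMapCone f) d)

theorem coneQuotient_realize_outerLayer (x : K.Space) :
    (coneQuotient f).realize C M ((outerLayer A).realize K C x) =
      (targetInclusion f).realize L M (f.realize K L x) := by
  apply M.bary_injective
  simp only [SimplicialMap.bary_realize, pushWeight_pushWeight]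
  rfl

variable {C} in
/-- The map of mapping cones determined by an identification of the topological cone with the
simplicial cone. -/
noncomputable def mapConeMap (Φ : TopCone K.Space ≃ₜ C.Space)
    (hΦ : ∀ x, Φ (TopCone.mk x 1) = (outerLayer A).realize K C x) :
    C(TopMapCone (f.realize K L), M.Space) :=
  TopMapCone.lift
    ⟨fun z => (coneQuotient f).realize C M (Φ z),
      ((coneQuotient f).continuous_realize C M).comp Φ.continuous⟩
    ⟨(targetInclusion f).realize L M, (targetInclusion f).continuous_realize L M⟩
    fun x => (congrArg _ (hΦ x)).trans (coneQuotient_realize_outerLayer f K L C M x)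

/-- The map of mapping cones determined by the identification `coneHomeo`. -/
noncomputable def stdMapConeMap : C(TopMapCone (f.realize K L), M.Space) :=
  mapConeMap f K L M (coneHomeo K C) (coneMap_mk_one K C)

theorem bary_stdMapConeMap_mk (x : K.Space) (t : I) :
    M.bary (stdMapConeMap f K L C M (TopMapCone.ofCone _ (TopCone.mk x t))) =
      mapConeWeight f (K.bary x) t := by
  refine ((coneQuotient f).bary_realize C M _).trans ?_
  rw [coneHomeo_apply, bary_coneMap_mk]
  rfl

theorem bary_stdMapConeMap_apex :
    M.bary (stdMapConeMap f K L C M (TopMapCone.ofCone _ (TopCone.apex _))) =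
      pushWeight (coneQuotient f).toFun (apexWeight V) := by
  refine ((coneQuotient f).bary_realize C M _).trans ?_
  rw [coneHomeo_apply, bary_coneMap_apex]

theorem stdMapConeMap_ofTarget (y : L.Space) :
    stdMapConeMap f K L C M (TopMapCone.ofTarget _ y) = (targetInclusion f).realize L M y := rfl

theorem stdMapConeMap_surjective : Function.Surjective (stdMapConeMap f K L C M) := by
  intro y
  rcases exists_of_mem_simpMapCone (M.bary_mem y).2.2 with ⟨P, hP, h⟩ | ⟨b, hb, h⟩
  · obtain ⟨z, rfl⟩ := (coneQuotient f).exists_realize_eq C M y hP h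
    exact ⟨TopMapCone.ofCone _ ((coneHomeo K C).symm z),
      congrArg ((coneQuotient f).realize C M) ((coneHomeo K C).apply_symm_apply z)⟩
  · obtain ⟨y', rfl⟩ := (targetInclusion f).exists_realize_eq L M y hb h
    exact ⟨TopMapCone.ofTarget _ y', rfl⟩

/-- A point of the cone and a point of the target have the same image only if they are already
identified in the topological mapping cone. -/
theorem ofCone_eq_ofTarget_of_map_eq (z : TopCone K.Space) (y : L.Space)
    (h : stdMapConeMap f K L C M (TopMapCone.ofCone _ z) =
      stdMapConeMap f K L C M (TopMapCone.ofTarget _ y)) :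
    TopMapCone.ofCone (f.realize K L) z = TopMapCone.ofTarget _ y := by
  have hb := congrArg M.bary h
  rw [stdMapConeMap_ofTarget, SimplicialMap.bary_realize] at hb
  have hnone : pushWeight (targetInclusion f).toFun (L.bary y) none = 0 := by
    simp [pushWeight, targetInclusion]
  have hinl : ∀ v, pushWeight (targetInclusion f).toFun (L.bary y) (some (Sum.inl v)) = 0 := by
    simp [pushWeight, targetInclusion]
  induction z using TopCone.ind with
  | h0 =>
    rw [bary_stdMapConeMap_apex] at hb
    have := congrFun hb none
    rw [pushWeight_coneQuotient_none, hnone] at this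
    exact absurd this one_ne_zero
  | h x t =>
    rw [bary_stdMapConeMap_mk] at hb
    have h0 := congrFun hb none
    rw [hnone, mapConeWeight, pushWeight_coneQuotient_none, coneWeight_none] at h0
    have ht : 1 ≤ 2 * (t : ℝ) := by linarith [le_max_right 0 (1 - 2 * (t : ℝ))]
    -- The inner layer carries no mass, so the top part is everything and `t = 1`.
    have h1 : ∀ v, K.bary x v = topPart (K.bary x) (2 * t - 1) v := fun v => by
      have := congrFun hb (some (Sum.inl v))
      rw [hinl, mapConeWeight, pushWeight_coneQuotient_inl, coneWeight_inner,
        (coneWeight_of_ge ht).2.1, (coneWeight_of_ge ht).2.2, one_mul] at this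
      linarith
    have h2 : ∑ v, topPart (K.bary x) (2 * t - 1) v = min (2 * t - 1 : ℝ) 1 := by
      rw [sum_topPart (by linarith), (K.bary_mem x).2.1]
    rw [← Finset.sum_congr rfl fun v _ => h1 v, (K.bary_mem x).2.1] at h2
    have h3 : (1 : ℝ) ≤ 2 * t - 1 := h2.le.trans (min_le_left _ _)
    obtain rfl : t = 1 := Subtype.ext (le_antisymm t.2.2 (by simp only [Set.Icc.coe_one]; linarith))
    rw [TopMapCone.ofCone_mk_one] at h ⊢
    rw [(targetInclusion f).realize_injective (targetInclusion_injective f) L M h]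

/-- Two distinct points are identified by the map of mapping cones only if they lie on the outer
half of the cone, at the same time. -/
theorem eq_or_exists_of_map_eq (p p' : TopMapCone (f.realize K L))
    (h : stdMapConeMap f K L C M p = stdMapConeMap f K L C M p') :
    p = p' ∨ ∃ (x x' : K.Space) (t : I), 1 ≤ 2 * (t : ℝ) ∧
      p = TopMapCone.ofCone _ (TopCone.mk x t) ∧ p' = TopMapCone.ofCone _ (TopCone.mk x' t) ∧
      mapConeWeight f (K.bary x) t = mapConeWeight f (K.bary x') t := by
  have hmk : ∀ (x x' : K.Space) (t t' : I),
      mapConeWeight f (K.bary x) t = mapConeWeight f (K.bary x') t' → t = t' ∧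
        (2 * (t : ℝ) ≤ 1 → TopCone.mk x t = TopCone.mk x' t') := fun x x' t t' h => by
    obtain rfl : t = t' := Subtype.ext (time_eq_of_mapConeWeight_eq (K.bary_mem x).2.1
      (K.bary_mem x').2.1 t.2.2 t'.2.2 h)
    refine ⟨rfl, fun ht => ?_⟩
    rcases t.2.1.eq_or_lt with h0 | h0
    · obtain rfl : 0 = t := Subtype.ext h0
      rw [TopCone.mk_zero, TopCone.mk_zero]
    · have h1 := (mapConeWeight_eq_iff.1 h).1
      rw [(coneWeight_of_le (K.bary_mem x).1 ht).2.2,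
        (coneWeight_of_le (K.bary_mem x').1 ht).2.2, min_eq_right ht] at h1
      have : K.bary x = K.bary x' := funext fun v =>
        mul_left_cancel₀ (by linarith : (2 * (t : ℝ)) ≠ 0) (by simpa using h1 v)
      rw [K.bary_injective this]
  have hapex : ∀ (x : K.Space) (t : I),
      pushWeight (coneQuotient f).toFun (apexWeight V) = mapConeWeight f (K.bary x) t →
        TopCone.apex _ = TopCone.mk x t := fun x t h => by
    rw [← TopCone.mk_zero x]
    rw [← coneWeight_zero (K.bary_mem x).1] at h
    exact (hmk x x 0 t h).2 (by simp)
  induction p using TopMapCone.ind with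
  | h z =>
    induction p' using TopMapCone.ind with
    | h z' =>
      have hb := congrArg M.bary h
      induction z using TopCone.ind with
      | h0 =>
        rw [bary_stdMapConeMap_apex] at hb
        induction z' using TopCone.ind with
        | h0 => exact Or.inl rfl
        | h x' t' =>
          rw [bary_stdMapConeMap_mk] at hb
          exact Or.inl (congrArg _ (hapex x' t' hb))
      | h x t =>
        rw [bary_stdMapConeMap_mk] at hb
        induction z' using TopCone.ind with
        | h0 =>
          rw [bary_stdMapConeMap_apex] at hb
          exact Or.inl (congrArg _ (hapex x t hb.symm).symm)
        | h x' t' =>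
          rw [bary_stdMapConeMap_mk] at hb
          obtain ⟨rfl, ht⟩ := hmk x x' t t' hb
          rcases le_total (2 * (t : ℝ)) 1 with h1 | h1
          · exact Or.inl (congrArg _ (ht h1))
          · exact Or.inr ⟨x, x', t, h1, rfl, rfl, hb⟩
    | h' y => exact Or.inl (ofCone_eq_ofTarget_of_map_eq f K L C M z y h)
  | h' y =>
    induction p' using TopMapCone.ind with
    | h z => exact Or.inl (ofCone_eq_ofTarget_of_map_eq f K L C M z y h.symm).symm
    | h' y' =>
      exact Or.inl (congrArg _
        ((targetInclusion f).realize_injective (targetInclusion_injective f) L M h))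

theorem isHomotopyEquivalence_stdMapConeMap :
    IsHomotopyEquivalence (stdMapConeMap f K L C M) := by
  refine isHomotopyEquivalence_of_surjective _ (stdMapConeMap_surjective f K L C M)
    (TopMapCone.stretch _) (TopMapCone.stretch_zero _) (fun τ p p' h => ?_) fun p p' h => ?_
  · rcases eq_or_exists_of_map_eq f K L C M p p' h with rfl | ⟨x, x', t, ht, rfl, rfl, hw⟩
    · rfl
    · rw [TopMapCone.stretch_mk, TopMapCone.stretch_mk]
      apply M.bary_injective
      rw [bary_stdMapConeMap_mk, bary_stdMapConeMap_mk]
      exact mapConeWeight_eq_of_le ht (TopMapCone.le_stretchTime τ t) hw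
  · rcases eq_or_exists_of_map_eq f K L C M p p' h with rfl | ⟨x, x', t, ht, rfl, rfl, hw⟩
    · rfl
    · rw [TopMapCone.stretch_mk, TopMapCone.stretch_mk, TopMapCone.stretchTime_one_left ht,
        TopMapCone.ofCone_mk_one, TopMapCone.ofCone_mk_one]
      refine congrArg _ (L.bary_injective ?_)
      rw [SimplicialMap.bary_realize, SimplicialMap.bary_realize]
      have h1 := (mapConeWeight_eq_iff.1 hw)
      rw [(coneWeight_of_ge ht).2.1] at h1
      simp only [one_mul] at h1
      obtain ⟨h1, h2⟩ := h1
      have key : ∀ (x : V → ℝ) s, pushWeight f.toFun x =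
          pushWeight f.toFun (x - topPart x s) + pushWeight f.toFun (topPart x s) := fun x s => by
        rw [← pushWeight_add, sub_add_cancel]
      rw [key (K.bary x) (max 0 (2 * t - 1)), key (K.bary x') (max 0 (2 * t - 1)), h2]
      congr 2
      exact funext h1

variable {C}

/-- Any two identifications of the topological cone with the simplicial cone that agree on the base
differ by a homeomorphism of the cone fixing the base, so the homotopy equivalence for one of them
gives it for all. -/
theorem isHomotopyEquivalence_mapConeMap (Φ : TopCone K.Space ≃ₜ C.Space)
    (hΦ : ∀ x, Φ (TopCone.mk x 1) = (outerLayer A).realize K C x) :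
    IsHomotopyEquivalence (mapConeMap f K L M Φ hΦ) := by
  have h1 : ∀ x, Φ.trans (coneHomeo K C).symm (TopCone.mk x 1) = TopCone.mk x 1 := fun x => by
    rw [Homeomorph.trans_apply, hΦ, Homeomorph.symm_apply_eq]
    exact (coneMap_mk_one K C x).symm
  have h := (isHomotopyEquivalence_stdMapConeMap f K L C M).comp_homeomorph
    (TopMapCone.homeoOfCone (f.realize K L) _ h1)
  convert h using 1
  ext1 p
  induction p using TopMapCone.ind with
  | h z =>
    exact congrArg ((coneQuotient f).realize C M) ((coneHomeo K C).apply_symm_apply (Φ z)).symm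
  | h' y => rfl

end MapCone

/-! ### Counting simplices -/

section Counting

theorem PreAbstractSimplicialComplex.ncard_map_faces {U U' : Type*} [DecidableEq U']
    (A : PreAbstractSimplicialComplex U) {g : U → U'} (hg : Function.Injective g) :
    (A.map g).faces.ncard = A.faces.ncard :=
  Set.ncard_image_of_injective _ (Finset.image_injective hg)

theorem ncard_coneOff {U : Type*} [Finite U] [DecidableEq U]
    {A S : PreAbstractSimplicialComplex U} (h : S.faces ⊆ A.faces) :
    (coneOff A S).faces.ncard = A.faces.ncard + S.faces.ncard + 1 := by
  have hS : (∅ : Finset U) ∉ S.faces := fun h => (S.isRelLowerSet_faces h).1.ne_empty rfl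
  have hg : Function.Injective fun s : Finset U => insert none (s.image some) := fun s t hst => by
    have e : ∀ s : Finset U, (insert none (s.image some)).eraseNone = s := fun s => by
      ext
      simp
    rw [← e s, ← e t]
    exact congrArg _ hst
  have hfaces : (coneOff A S).faces = (A.map some).faces ∪
      (fun s : Finset U => insert none (s.image some)) '' insert ∅ S.faces := by
    ext t
    constructor
    · rintro (ht | ⟨hne, ht⟩)
      · exact Or.inl ht
      · by_cases hn : none ∈ t
        · exact Or.inr ⟨t.eraseNone, ht, by ext p; cases p <;> simp [hn]⟩
        · have he : t.eraseNone.image some = t := by ext p; cases p <;> simp [hn]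
          refine Or.inl ⟨t.eraseNone, ?_, he⟩
          rcases ht with ht | ht
          · rw [ht, Finset.image_empty] at he
            exact absurd he.symm hne.ne_empty
          · exact h ht
    · rintro (ht | ⟨s, hs, rfl⟩)
      · exact Or.inl ht
      · exact insert_none_image_mem_coneOff A S hs
  rw [hfaces, Set.ncard_union_eq ?_ (Set.toFinite _) (Set.toFinite _),
    A.ncard_map_faces (Option.some_injective U), Set.ncard_image_of_injective _ hg,
    Set.ncard_insert_of_notMem hS, add_assoc]
  rw [Set.disjoint_left]
  rintro _ ⟨s, -, rfl⟩ ⟨t, -, ht⟩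
  have : none ∈ s.image some := by
    rw [show s.image some = _ from ht.symm]
    simp
  simp at this

variable {V W : Type*} [LinearOrder V] [DecidableEq W] {A : AbstractSimplicialComplex V}
  {B : AbstractSimplicialComplex W}

/-- `SplitCode u y c` says how a chain `c` of simplices of the source encodes the inner part `u` of
a simplex of the simplicial mapping cylinder with outer part `y`. If `z` is a set of vertices above
`u`, with image `y`, then the simplex `u ∪ z` is recorded alone when `z` starts at the last vertex
of `u` and has as many vertices as `y`, and is recorded together with `z` when `z` is disjoint from
`u`. The four cases are: no inner part, no outer part, and the two ways to record `z`. -/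
def SplitCode (u : Finset V) (y : Finset W) (c : Finset (Finset V)) : Prop :=
  (u = ∅ ∧ c = ∅) ∨ (u.Nonempty ∧ y = ∅ ∧ c = {u}) ∨
    (y.Nonempty ∧ ∃ m ∈ u, ∃ z : Finset V, m ∈ z ∧ (∀ v ∈ u, v ≤ m) ∧ (∀ v ∈ z, m ≤ v) ∧
      z.card = y.card ∧ c = {u ∪ z}) ∨
    (u.Nonempty ∧ y.Nonempty ∧ ∃ z : Finset V, Disjoint u z ∧ c = {z, u ∪ z})

theorem card_pair_of_disjoint {u z : Finset V} (hu : u.Nonempty) (h : Disjoint u z) :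
    ({z, u ∪ z} : Finset (Finset V)).card = 2 := by
  refine Finset.card_pair fun e => ?_
  obtain ⟨v, hv⟩ := hu
  have hvz : v ∈ z := by
    rw [e]
    exact Finset.mem_union_left _ hv
  exact Finset.disjoint_left.1 h hv hvz

theorem SplitCode.unique_of_le {u u' z z' : Finset V} {m m' : V} (hm : m ∈ u) (hm' : m' ∈ u')
    (hmz : m ∈ z) (hum : ∀ v ∈ u, v ≤ m) (hum' : ∀ v ∈ u', v ≤ m')
    (hzm : ∀ v ∈ z, m ≤ v) (hzm' : ∀ v ∈ z', m' ≤ v) (hcard : z.card = z'.card)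
    (h : u ∪ z = u' ∪ z') (hle : m ≤ m') : u = u' := by
  have hmem : ∀ v, v ∈ u ∨ v ∈ z ↔ v ∈ u' ∨ v ∈ z' := fun v => by
    rw [← Finset.mem_union, h, Finset.mem_union]
  -- The upper parts are nested and of the same size.
  have hzz : z' ⊆ z := fun v hv => by
    rcases (hmem v).2 (Or.inr hv) with h1 | h1
    · rwa [le_antisymm (hum v h1) (hle.trans (hzm' v hv))]
    · exact h1
  have hz : z' = z := Finset.eq_of_subset_of_card_le hzz hcard.le
  subst hz
  obtain rfl : m = m' := le_antisymm hle (hzm' m hmz)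
  ext v
  constructor
  · intro hv
    rcases (hmem v).1 (Or.inl hv) with h1 | h1
    · exact h1
    · rwa [le_antisymm (hum v hv) (hzm v h1)]
  · intro hv
    rcases (hmem v).2 (Or.inl hv) with h1 | h1
    · exact h1
    · rwa [le_antisymm (hum' v hv) (hzm v h1)]

omit [DecidableEq W] in
/-- The inner part is determined by its code and the outer part. -/
theorem SplitCode.unique {u u' : Finset V} {y : Finset W} {c : Finset (Finset V)}
    (h : SplitCode u y c) (h' : SplitCode u' y c) : u = u' := by
  rcases h with ⟨rfl, rfl⟩ | ⟨hu, rfl, rfl⟩ | ⟨hy, m, hm, z, hmz, hum, hzm, hz, rfl⟩ |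
    ⟨hu, hy, z, hd, rfl⟩
  · rcases h' with ⟨rfl, -⟩ | ⟨-, -, h⟩ | ⟨_, _, _, _, _, _, _, _, h⟩ | ⟨-, -, z', -, h⟩
    · rfl
    · exact absurd h.symm (Finset.singleton_ne_empty _)
    · exact absurd h.symm (Finset.singleton_ne_empty _)
    · exact absurd h.symm (Finset.insert_ne_empty _ _)
  · rcases h' with ⟨-, h⟩ | ⟨-, -, h⟩ | ⟨hy, -⟩ | ⟨-, hy, -⟩
    · exact absurd h (Finset.singleton_ne_empty _)
    · exact Finset.singleton_injective h
    · exact absurd rfl hy.ne_empty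
    · exact absurd rfl hy.ne_empty
  · rcases h' with ⟨-, h⟩ | ⟨-, rfl, -⟩ | ⟨-, m', hm', z', hmz', hum', hzm', hz', h⟩ |
      ⟨hu', -, z', hd', h⟩
    · exact absurd h (Finset.singleton_ne_empty _)
    · exact absurd rfl hy.ne_empty
    · have e := Finset.singleton_injective h
      rcases le_total m m' with hle | hle
      · exact unique_of_le hm hm' hmz hum hum' hzm hzm' (hz.trans hz'.symm) e hle
      · exact (unique_of_le hm' hm hmz' hum' hum hzm' hzm (hz'.trans hz.symm) e.symm hle).symm
    · have := card_pair_of_disjoint hu' hd'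
      rw [← h, Finset.card_singleton] at this
      omega
  · rcases h' with ⟨-, h⟩ | ⟨-, rfl, -⟩ | ⟨_, _, _, _, _, _, _, _, h⟩ | ⟨hu', -, z', hd', h⟩
    · exact absurd h (Finset.insert_ne_empty _ _)
    · exact absurd rfl hy.ne_empty
    · have := card_pair_of_disjoint hu hd
      rw [h, Finset.card_singleton] at this
      omega
    · have h1 : z ∈ ({z', u' ∪ z'} : Finset (Finset V)) := by simp [← h]
      have h2 : z' ∈ ({z, u ∪ z} : Finset (Finset V)) := by simp [h]
      have h3 : u ∪ z ∈ ({z', u' ∪ z'} : Finset (Finset V)) := by simp [← h]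
      simp only [Finset.mem_insert, Finset.mem_singleton] at h1 h2 h3
      have h4 : z' ⊆ z := by
        rcases h1 with h1 | h1 <;> rw [h1]
        exact Finset.subset_union_right
      have h5 : z ⊆ z' := by
        rcases h2 with h2 | h2 <;> rw [h2]
        exact Finset.subset_union_right
      obtain rfl : z = z' := h5.antisymm h4
      rcases h3 with h3 | h3
      · obtain ⟨v, hv⟩ := hu
        have hvz : v ∈ z := by
          rw [← h3]
          exact Finset.mem_union_left _ hv
        exact absurd hvz (Finset.disjoint_left.1 hd hv)
      · rw [← Finset.union_sdiff_cancel_right hd, h3, Finset.union_sdiff_cancel_right hd']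

/-- The two parts of a simplex of the simplicial mapping cylinder. -/
theorem exists_of_mem_simpMapCyl {f : SimplicialMap A B} {T : Finset (V ⊕ W)}
    (hT : T ∈ (simpMapCyl f).faces) : (T.toLeft = ∅ ∧ T.toRight ∈ B.faces) ∨
      ∃ z : Finset V, T.toLeft ∪ z ∈ A.faces ∧ (∀ v ∈ T.toLeft, ∀ v' ∈ z, v ≤ v') ∧
        z.image f.toFun = T.toRight := by
  rcases hT with ⟨P, ⟨hne, s, hs, k, hk, hP⟩, rfl⟩ | ⟨b, hb, rfl⟩
  · let z : Finset V := (P.filter fun p => p.2 = 1).image Prod.fst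
    have hz : ∀ v, v ∈ z ↔ (v, 1) ∈ P := fun v => by simp [z]
    have hl : ∀ v, v ∈ (P.image (cylVertex f)).toLeft ↔ (v, 0) ∈ P := fun v => by
      simp only [Finset.mem_toLeft, Finset.mem_image]
      constructor
      · rintro ⟨⟨v', i⟩, hp, h⟩
        fin_cases i
        · obtain rfl := Sum.inl_injective h
          exact hp
        · exact absurd h Sum.inr_ne_inl
      · exact fun h => ⟨_, h, rfl⟩
    have hr : z.image f.toFun = (P.image (cylVertex f)).toRight := by
      ext w
      simp only [Finset.mem_toRight, Finset.mem_image, hz]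
      constructor
      · rintro ⟨v, hv, rfl⟩
        exact ⟨_, hv, rfl⟩
      · rintro ⟨⟨v', i⟩, hp, h⟩
        fin_cases i
        · exact absurd h Sum.inl_ne_inr
        · exact ⟨v', hp, Sum.inr_injective h⟩
    have h0 : ∀ v, (v, 0) ∈ P → v ∈ s ∧ v ≤ k := fun v hv => by
      simpa [prismSimplex] using hP hv
    have h1 : ∀ v, (v, 1) ∈ P → v ∈ s ∧ k ≤ v := fun v hv => by
      simpa [prismSimplex] using hP hv
    refine Or.inr ⟨z, (A.isRelLowerSet_faces hs).2 (fun v hv => ?_) ?_, fun v hv v' hv' =>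
      (h0 v ((hl v).1 hv)).2.trans (h1 v' ((hz v').1 hv')).2, hr⟩
    · rcases Finset.mem_union.1 hv with hv | hv
      exacts [(h0 v ((hl v).1 hv)).1, (h1 v ((hz v).1 hv)).1]
    · obtain ⟨⟨v, i⟩, hp⟩ := hne
      refine ⟨v, ?_⟩
      fin_cases i
      · exact Finset.mem_union_left _ ((hl v).2 hp)
      · exact Finset.mem_union_right _ ((hz v).2 hp)
  · refine Or.inl ⟨?_, ?_⟩
    · ext v
      simp
    · have : (b.image (Sum.inr : W → V ⊕ W)).toRight = b := by
        ext v
        simp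
      rwa [this]

/-- Every pair of parts of a simplex of the simplicial mapping cylinder, with nonempty inner part,
is encoded by a nonempty chain of simplices of the source whose images contain the outer part. -/
theorem exists_splitCode {f : SimplicialMap A B} {u z : Finset V} (hu : u.Nonempty)
    (huz : u ∪ z ∈ A.faces) (hle : ∀ v ∈ u, ∀ v' ∈ z, v ≤ v') :
    ∃ c : Finset (Finset V), SplitCode u (z.image f.toFun) c ∧ c.Nonempty ∧
      IsChain (· ⊆ ·) (c : Set (Finset V)) ∧
      ∀ s ∈ c, s ∈ A.faces ∧ z.image f.toFun ⊆ s.image f.toFun := by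
  rcases z.eq_empty_or_nonempty with rfl | hz
  · rw [Finset.union_empty] at huz
    exact ⟨{u}, Or.inr (Or.inl ⟨hu, Finset.image_empty _, rfl⟩), Finset.singleton_nonempty _,
      by simp, by simpa using huz⟩
  have hm := u.max'_mem hu
  set m := u.max' hu with hm_def
  have hum : ∀ v ∈ u, v ≤ m := fun v hv => u.le_max' v hv
  by_cases hfm : f.toFun m ∈ z.image f.toFun
  · -- The last vertex of `u` serves as the preimage of its image, and the other vertices of the
    -- outer part get one preimage each.
    obtain ⟨z₁, hz₁, hinj, himg⟩ := Finset.exists_subset_injOn_image_eq_of_surjOn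
      (f := f.toFun) (z : Set V) ((z.image f.toFun).erase (f.toFun m)) (by
        intro w hw
        obtain ⟨v, hv, rfl⟩ := Finset.mem_image.1 (Finset.mem_of_mem_erase (Finset.mem_coe.1 hw))
        exact ⟨v, hv, rfl⟩)
    have hz₁' : z₁ ⊆ z := Finset.coe_subset.1 hz₁
    have hcard : (insert m z₁).card = (z.image f.toFun).card := by
      have hmz : m ∉ z₁ := fun h => by
        have := Finset.mem_image_of_mem f.toFun h
        rw [himg] at this
        simp at this
      rw [Finset.card_insert_of_notMem hmz, ← Finset.card_image_of_injOn hinj, himg,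
        Finset.card_erase_add_one hfm]
    have himg' : (insert m z₁).image f.toFun = z.image f.toFun := by
      rw [Finset.image_insert, himg, Finset.insert_erase hfm]
    refine ⟨{u ∪ insert m z₁}, Or.inr (Or.inr (Or.inl ⟨hz.image _, m, hm, insert m z₁,
      Finset.mem_insert_self _ _, hum, fun v hv => ?_, hcard, rfl⟩)),
      Finset.singleton_nonempty _, by simp, fun s hs => ?_⟩
    · rcases Finset.mem_insert.1 hv with rfl | hv
      exacts [le_rfl, hle m hm v (hz₁' hv)]
    · rw [Finset.mem_singleton.1 hs]
      refine ⟨(A.isRelLowerSet_faces huz).2 ?_ (hu.mono Finset.subset_union_left), ?_⟩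
      · exact Finset.union_subset Finset.subset_union_left (Finset.insert_subset
          (Finset.mem_union_left _ hm) (hz₁'.trans Finset.subset_union_right))
      · rw [← himg']
        exact Finset.image_subset_image Finset.subset_union_right
  · have hd : Disjoint u z := Finset.disjoint_left.2 fun v hv hvz => hfm (by
      rw [le_antisymm (hle m hm v hvz) (hum v hv)]
      exact Finset.mem_image_of_mem _ hvz)
    refine ⟨{z, u ∪ z}, Or.inr (Or.inr (Or.inr ⟨hu, hz.image _, z, hd, rfl⟩)),
      Finset.insert_nonempty _ _, ?_, fun s hs => ?_⟩
    · rw [Finset.coe_pair]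
      exact IsChain.pair Finset.subset_union_right
    · rcases Finset.mem_insert.1 hs with rfl | hs
      · exact ⟨(A.isRelLowerSet_faces huz).2 Finset.subset_union_right hz, subset_rfl⟩
      · rw [Finset.mem_singleton.1 hs]
        exact ⟨huz, Finset.image_subset_image Finset.subset_union_right⟩

/-- Every simplex of the simplicial mapping cylinder is encoded by a simplex of the two-layer
cylinder with the same outer part. -/
theorem exists_mem_cohenCyl {f : SimplicialMap A B} {T : Finset (V ⊕ W)}
    (hT : T ∈ (simpMapCyl f).faces) : ∃ Q ∈ (cohenCyl f).faces, Q.toRight = T.toRight ∧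
      SplitCode T.toLeft T.toRight (Q.toLeft.image Subtype.val) := by
  classical
  have hparts : (T.toLeft = ∅ ∧ T.toRight ∈ B.faces) ∨ (T.toLeft.Nonempty ∧
      ∃ z : Finset V, T.toLeft ∪ z ∈ A.faces ∧ (∀ v ∈ T.toLeft, ∀ v' ∈ z, v ≤ v') ∧
        z.image f.toFun = T.toRight) := by
    rcases exists_of_mem_simpMapCyl hT with h | ⟨z, hz, hle, hzT⟩
    · exact Or.inl h
    · rcases T.toLeft.eq_empty_or_nonempty with he | he
      · refine Or.inl ⟨he, ?_⟩
        rw [he, Finset.empty_union] at hz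
        rw [← hzT]
        exact f.map_faces z hz
      · exact Or.inr ⟨he, z, hz, hle, hzT⟩
  rcases hparts with ⟨he, hr⟩ | ⟨he, z, hz, hle, hzT⟩
  · have hl' := Finset.toLeft_disjSum (s := (∅ : Finset A.faces)) (t := T.toRight)
    have hr' := Finset.toRight_disjSum (s := (∅ : Finset A.faces)) (t := T.toRight)
    obtain ⟨w, hw⟩ := (B.isRelLowerSet_faces hr).1
    exact ⟨Finset.disjSum ∅ T.toRight, ⟨⟨Sum.inr w, Finset.inr_mem_disjSum.2 hw⟩,
      by rw [hl']; simp, Or.inr (by rwa [hr']), by rw [hl']; simp⟩, hr',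
      Or.inl ⟨he, by rw [hl']; simp⟩⟩
  · obtain ⟨c, hc, hcne, hchain, hcA⟩ := exists_splitCode (f := f) he hz hle
    rw [hzT] at hc hcA
    let c' : Finset A.faces := c.subtype (· ∈ A.faces)
    have hc' : c'.image Subtype.val = c := by
      ext s
      simpa [c'] using fun hs => (hcA s hs).1
    have hmem : ∀ s : A.faces, s ∈ c' ↔ s.1 ∈ c := fun s => by simp [c']
    obtain ⟨s, hs⟩ := hcne
    refine ⟨Finset.disjSum c' T.toRight, ⟨⟨Sum.inl ⟨s, (hcA s hs).1⟩, ?_⟩, ?_, ?_, ?_⟩, by simp, ?_⟩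
    · simpa [hmem] using hs
    · rw [Finset.toLeft_disjSum]
      intro s hs t ht hst
      exact hchain ((hmem s).1 hs) ((hmem t).1 ht) fun h => hst (Subtype.ext h)
    · rw [Finset.toRight_disjSum]
      rcases T.toRight.eq_empty_or_nonempty with h | h
      · exact Or.inl h
      · exact Or.inr ((B.isRelLowerSet_faces (f.map_faces s (hcA s hs).1)).2 (hcA s hs).2 h)
    · rw [Finset.toLeft_disjSum, Finset.toRight_disjSum]
      exact fun t ht => (hcA t ((hmem t).1 ht)).2
    · rwa [Finset.toLeft_disjSum, hc']

variable [Fintype V] [Fintype W]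

theorem ncard_simpMapCyl_le (f : SimplicialMap A B) :
    (simpMapCyl f).faces.ncard ≤ (cohenCyl f).faces.ncard := by
  classical
  have h : ∀ T : Finset (V ⊕ W), ∃ Q : Finset (A.faces ⊕ W), T ∈ (simpMapCyl f).faces →
      Q ∈ (cohenCyl f).faces ∧ Q.toRight = T.toRight ∧
        SplitCode T.toLeft T.toRight (Q.toLeft.image Subtype.val) := fun T => by
    by_cases hT : T ∈ (simpMapCyl f).faces
    · obtain ⟨Q, hQ⟩ := exists_mem_cohenCyl hT
      exact ⟨Q, fun _ => hQ⟩
    · exact ⟨∅, fun h => absurd h hT⟩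
  choose e he using h
  refine Set.ncard_le_ncard_of_injOn e (fun T hT => (he T hT).1) (fun T hT T' hT' hTT => ?_)
    (Set.toFinite _)
  obtain ⟨-, h1, h2⟩ := he T hT
  obtain ⟨-, h1', h2'⟩ := he T' hT'
  rw [← hTT] at h1' h2'
  have hr : T.toRight = T'.toRight := h1.symm.trans h1'
  rw [← hr] at h2'
  rw [← T.toLeft_disjSum_toRight, ← T'.toLeft_disjSum_toRight, hr, h2.unique h2']

omit [LinearOrder V] [Fintype V] in
theorem singleton_mem_barySubdiv (s : A.faces) :
    {s} ∈ (barySubdiv A).faces :=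
  ⟨Finset.singleton_nonempty _, by simp⟩

omit [LinearOrder V] [Fintype V] in
theorem ncard_range_singleton_faces :
    (Set.range fun s : A.faces => ({s} : Finset A.faces)).ncard = A.faces.ncard := by
  rw [← Set.image_univ, Set.ncard_image_of_injective _ Finset.singleton_injective, Set.ncard_univ,
    Nat.card_coe_set_eq]

omit [LinearOrder V] in
theorem ncard_faces_le_barySubdiv (A : AbstractSimplicialComplex V) :
    A.faces.ncard ≤ (barySubdiv A).faces.ncard := by
  rw [← ncard_range_singleton_faces]
  refine Set.ncard_le_ncard ?_ (Set.toFinite _)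
  rintro _ ⟨s, rfl⟩
  exact singleton_mem_barySubdiv s

/-- An edge and one of its vertices form a chain that is not a single simplex. -/
theorem ncard_faces_lt_barySubdiv (h : ∃ s ∈ A.faces, 2 ≤ s.card) :
    A.faces.ncard < (barySubdiv A).faces.ncard := by
  classical
  obtain ⟨s, hs, hcard⟩ := h
  obtain ⟨v, hv⟩ := (A.isRelLowerSet_faces hs).1
  have hne : (⟨{v}, A.singleton_mem v⟩ : A.faces) ≠ ⟨s, hs⟩ := fun h => by
    have := congrArg (fun t : A.faces => t.1.card) h
    simp only [Finset.card_singleton] at this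
    omega
  rw [← ncard_range_singleton_faces]
  refine Set.ncard_lt_ncard ⟨?_, fun hsub => ?_⟩ (Set.toFinite _)
  · rintro _ ⟨s, rfl⟩
    exact singleton_mem_barySubdiv s
  · have hmem : ({⟨{v}, A.singleton_mem v⟩, ⟨s, hs⟩} : Finset A.faces) ∈ (barySubdiv A).faces := by
      refine ⟨Finset.insert_nonempty _ _, ?_⟩
      rw [Finset.coe_pair]
      exact IsChain.pair (Finset.singleton_subset_iff.2 hv)
    obtain ⟨t, ht⟩ := hsub hmem
    have := congrArg Finset.card ht
    rw [Finset.card_pair hne] at this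
    simp at this

theorem ncard_simpMapCone (f : SimplicialMap A B) : (simpMapCone f).faces.ncard =
    (simpMapCyl f).faces.ncard + A.faces.ncard + 1 := by
  refine (ncard_coneOff ?_).trans ?_
  · rintro _ ⟨s, hs, rfl⟩
    have hne := (A.isRelLowerSet_faces hs).1
    refine Or.inl ⟨s.image fun v => (v, 0), ⟨hne.image _, s, hs, s.max' hne, s.max'_mem hne,
      fun p hp => ?_⟩, ?_⟩
    · obtain ⟨v, hv, rfl⟩ := Finset.mem_image.1 hp
      exact Finset.mem_union_left _
        (Finset.mem_image_of_mem _ (Finset.mem_filter.2 ⟨hv, s.le_max' v hv⟩))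
    · simp only [Finset.image_image]
      rfl
  · rw [PreAbstractSimplicialComplex.ncard_map_faces _ Sum.inl_injective]

theorem ncard_cohenMapCone (f : SimplicialMap A B) : (cohenMapCone f).faces.ncard =
    (cohenCyl f).faces.ncard + (barySubdiv A).faces.ncard + 1 := by
  refine (ncard_coneOff ?_).trans ?_
  · rintro _ ⟨c, ⟨hne, hc⟩, rfl⟩
    have hl : (c.image (Sum.inl : A.faces → A.faces ⊕ W)).toLeft = c := by ext; simp
    have hr : (c.image (Sum.inl : A.faces → A.faces ⊕ W)).toRight = ∅ := by ext; simp
    exact ⟨hne.image _, by rwa [hl], Or.inl hr, by simp [hr]⟩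
  · rw [PreAbstractSimplicialComplex.ncard_map_faces _ Sum.inl_injective]

omit [Fintype V] [Fintype W] in
theorem image_inl_mem_whiteheadCyl (f : SimplicialMap A B) {s : Finset V} (hs : s ∈ A.faces) :
    s.image Sum.inl ∈ (whiteheadCyl f).faces := by
  have hl : (s.image (Sum.inr : V → A.faces ⊕ V)).toLeft = ∅ := by ext; simp
  have hr : (s.image (Sum.inr : V → A.faces ⊕ V)).toRight = s := by ext; simp
  refine Or.inl ⟨s.image Sum.inr, ⟨(A.isRelLowerSet_faces hs).1.image _, by simp [hl],
    Or.inr (by rwa [hr]), by simp [hl]⟩, ?_⟩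
  simp only [Finset.image_image]
  rfl

theorem ncard_whiteheadMapCone (f : SimplicialMap A B) : (whiteheadMapCone f).faces.ncard =
    (whiteheadCyl f).faces.ncard + A.faces.ncard + 1 := by
  refine (ncard_coneOff ?_).trans ?_
  · rintro _ ⟨s, hs, rfl⟩
    exact image_inl_mem_whiteheadCyl f hs
  · rw [PreAbstractSimplicialComplex.ncard_map_faces _ Sum.inl_injective]

/-- The three-layer cylinder contains the two-layer one, which misses the vertices of the inner
layer. -/
theorem ncard_cohenCyl_lt_whiteheadCyl [Nonempty V] (f : SimplicialMap A B) :
    (cohenCyl f).faces.ncard < (whiteheadCyl f).faces.ncard := by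
  rw [← (cohenCyl f).ncard_map_faces (Sum.inr_injective (α := V))]
  refine Set.ncard_lt_ncard ⟨fun T hT => Or.inr hT, fun hsub => ?_⟩ (Set.toFinite _)
  obtain ⟨v⟩ := ‹Nonempty V›
  obtain ⟨Q, -, hQ⟩ := hsub (image_inl_mem_whiteheadCyl f (A.singleton_mem v))
  have : Sum.inl v ∈ Q.image (Sum.inr : A.faces ⊕ W → V ⊕ (A.faces ⊕ W)) := by
    rw [show Q.image Sum.inr = _ from hQ]
    simp
  simp at this

end Counting

/-! ### The cone, the mapping cone and the count -/

theorem mainTheorem3 {V W : Type*} [Fintype V] [LinearOrder V] [Fintype W] [DecidableEq W]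
    (A : AbstractSimplicialComplex V) (B : AbstractSimplicialComplex W) (f : SimplicialMap A B)
    {a b c d : ℕ} (K : GeomRealization A a) (L : GeomRealization B b)
    (C : GeomRealization (simpCone A) c) (M : GeomRealization (simpMapCone f) d) :
    (∃ Φ : TopCone K.Space ≃ₜ C.Space,
      ∀ x : K.Space, Φ (TopCone.mk x 1) = (outerLayer A).realize K C x) ∧
    (∀ Φ : TopCone K.Space ≃ₜ C.Space,
      (∀ x : K.Space, Φ (TopCone.mk x 1) = (outerLayer A).realize K C x) →
      ∃ q : C(TopMapCone (f.realize K L), M.Space),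
        (∀ z : TopCone K.Space,
          q (TopMapCone.ofCone (f.realize K L) z) = (coneQuotient f).realize C M (Φ z)) ∧
        (∀ y : L.Space,
          q (TopMapCone.ofTarget (f.realize K L) y) = (targetInclusion f).realize L M y) ∧
        IsHomotopyEquivalence q) ∧
    (simpMapCone f).faces.ncard ≤ (cohenMapCone f).faces.ncard ∧
    ((∃ s ∈ A.faces, 2 ≤ s.card) →
      (simpMapCone f).faces.ncard < (cohenMapCone f).faces.ncard) ∧
    (Nonempty V → (simpMapCone f).faces.ncard < (whiteheadMapCone f).faces.ncard) := by
  refine ⟨⟨coneHomeo K C, coneMap_mk_one K C⟩, fun Φ hΦ => ⟨mapConeMap f K L M Φ hΦ, fun _ => rfl,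
    fun _ => rfl, isHomotopyEquivalence_mapConeMap f K L M Φ hΦ⟩, ?_, fun h => ?_, fun h => ?_⟩
  · rw [ncard_simpMapCone, ncard_cohenMapCone]
    have h1 := ncard_simpMapCyl_le f
    have h2 := ncard_faces_le_barySubdiv A
    omega
  · rw [ncard_simpMapCone, ncard_cohenMapCone]
    have h1 := ncard_simpMapCyl_le f
    have h2 := ncard_faces_lt_barySubdiv h
    omega
  · rw [ncard_simpMapCone, ncard_whiteheadMapCone]
    have h1 := ncard_simpMapCyl_le f
    have h2 := ncard_cohenCyl_lt_whiteheadCyl f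
    omega
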